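/- A CW-complex structure on a Hausdorff space is called *simple* if it has finitely many cells (so the space is compact), the space is the closure of the union of the cells of maximal dimension, and every closed cell is a closed ball, that is, the characteristic map of every cell is a homeomorphism of the closed ball $D^n$ onto the closure of the cell. For a space $X$ and an integer $d\ge 0$ let $\mathrm{Sym}^d(X)=X^d/S_d$ with the quotient topology; its points are the multisets of $d$ points of $X$. A *$d$-branched covering* (in the sense of Smith and Dold) between Hausdorff spaces $X,Y$ is a pair of continuous maps $h:X\to Y$ and $t:Y\to \mathrm{Sym}^d(X)$ such that $x\in t(h(x))$ for all $x\in X$ and $\mathrm{Sym}^d(h)(t(y))=d\cdot y$ for all $y\in Y$. It is called *finite* if $Y$ admits a simple CW-complex structure such that the function $y\mapsto |h^{-1}(y)|$ is constant on every (open) cell. **Theorem.** A Hausdorff space $\Omega$ admits the structure of a simple CW-complex if and only if, for some integers $n,d\ge 0$, there exists a finite $d$-branched covering $h:\Omega\to B$ over the closed ball $B=\{x\in\mathbb{R}^n : \|x\|\le 1\}$. (The empty space counts as a simple CW-complex; it is the case $d=0$.) -/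

import Mathlib

open Topology Set Metric

/-- The `d`-fold symmetric product of a space, the quotient of `X ^ d` by permutations of the
coordinates: `Sym X d` (multisets with `d` elements) with the quotient topology of the map
`(x₁, …, x_d) ↦ x₁ + ⋯ + x_d`. -/
instance symTopologicalSpace (X : Type*) [TopologicalSpace X] (d : ℕ) :
    TopologicalSpace (Sym X d) :=
  TopologicalSpace.coinduced
    (fun v : Fin d → X => (Sym.mk (Multiset.map v Finset.univ.val) (by simp) : Sym X d))
    inferInstance

/-- A CW structure on the whole space `X` is *simple* if it is finite (hence `X` is compact), `X`
is the closure of the union of the cells of maximal dimension, and every closed cell is a closed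
ball, i.e. every characteristic map is a homeomorphism of the closed ball onto its image (which
is the closure of the cell; in Mathlib the model ball is the one of the sup norm, a cube). -/
structure IsSimpleCWComplex (X : Type*) [TopologicalSpace X] [CWComplex (univ : Set X)] :
    Prop where
  finite : CWComplex.Finite (univ : Set X)
  pure : ∃ n : ℕ, (∀ m, n < m → IsEmpty (RelCWComplex.cell (univ : Set X) m)) ∧
    closure (⋃ e : RelCWComplex.cell (univ : Set X) n, RelCWComplex.openCell n e) = univ
  isEmbedding : ∀ (n : ℕ) (e : RelCWComplex.cell (univ : Set X) n),
    IsEmbedding (fun x : closedBall (0 : Fin n → ℝ) 1 => RelCWComplex.map n e x)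

/-- A `d`-fold branched covering in the sense of Smith and Dold: a continuous map `h : X → Y`
with a continuous transfer `t : Y → Sym X d` such that `x ∈ t (h x)` and `h` maps the multiset
`t y` to `d • y`. -/
structure BranchedCovering (d : ℕ) (X Y : Type*) [TopologicalSpace X] [TopologicalSpace Y] where
  proj : C(X, Y)
  transfer : C(Y, Sym X d)
  mem_transfer : ∀ x, x ∈ transfer (proj x)
  map_transfer : ∀ y, (transfer y).map proj = Sym.replicate d y

/-- A branched covering is *finite* if its base carries a simple CW structure such that the
number of points of a fibre is constant on every open cell. -/
def BranchedCovering.IsFinite {d : ℕ} {X Y : Type*} [TopologicalSpace X] [TopologicalSpace Y]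
    (h : BranchedCovering d X Y) : Prop :=
  ∃ _ : CWComplex (univ : Set Y), IsSimpleCWComplex Y ∧
    ∀ (n : ℕ) (e : RelCWComplex.cell (univ : Set Y) n),
      ∀ y ∈ RelCWComplex.openCell n e, ∀ y' ∈ RelCWComplex.openCell n e,
        (h.proj ⁻¹' {y}).encard = (h.proj ⁻¹' {y'}).encard

-- From complex to covering, the complex is subdivided barycentrically. The frontier of a (k+1)-cell
-- is a union of closed k-cells (`exists_closedCell_subset_cellFrontier`), so purity places every
-- point in a simplex spanned by the centres of a full flag of cells of dimensions 0, …, n. Vertices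
-- are coloured by dimension; barycentric coordinates therefore project all these simplices
-- compatibly onto one standard n-simplex, a ball, with one section per flag (`exists_simplices`).
-- The transfer lists the values of all sections, and d is the number of flags. Two sections agree
-- at y exactly when their flags agree at the nonzero coordinates of y, so the fibre size is
-- constant on open faces.
--
-- From covering to complex, the transfer makes the projection open and closed with finite fibres.
-- Constant fibre size makes it a genuine covering over each open cell
-- (`IsOpenMap.isCoveringMap_of_encard_eq`). A ball is simply connected, so characteristic maps
-- lift, and closedness with finite fibres extends the lifts to closed balls
-- (`exists_lift_closedBall`). The lifts are the cells of the total space; openness of the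
-- projection gives purity.
--
-- The statement on frontiers is the topological core. It compares a k-sphere with cells of
-- dimension at most k and rests on invariance of domain, which is derived from the absence of C¹
-- retractions of the ball onto its sphere.

universe u

/-! ### Invariance of domain, by an integral form of the no-retraction theorem. -/

section InvarianceOfDomain

open MeasureTheory

section Determinant

variable {E : Type*} [NormedAddCommGroup E] [NormedSpace ℝ E] [FiniteDimensional ℝ E]

/-- As a function of `t` the determinant is a polynomial of degree at most dim E, hence determined
by dim E + 1 values. This carries information from small `t` to `t = 1`. -/
theorem det_one_add_smul_eq_sum_lagrange (A : E →L[ℝ] E) {v : ℕ → ℝ} (hv : Function.Injective v)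
    (t : ℝ) :
    (1 + t • A).det = ∑ i ∈ Finset.range (Module.finrank ℝ E + 1),
      (1 + v i • A).det * (Lagrange.basis (Finset.range (Module.finrank ℝ E + 1)) v i).eval t := by
  classical
  set n := Module.finrank ℝ E
  let b : Module.Basis (Fin n) ℝ E := Module.finBasis ℝ E
  let M : Matrix (Fin n) (Fin n) ℝ := LinearMap.toMatrix b b (A : E →ₗ[ℝ] E)
  let q : Polynomial ℝ := ((Polynomial.X : Polynomial ℝ) • M.map (⇑Polynomial.C) +
    (1 : Matrix (Fin n) (Fin n) ℝ).map (⇑Polynomial.C)).det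
  have hq : ∀ s, q.eval s = (1 + s • A).det := by
    intro s
    rw [ContinuousLinearMap.det, ← LinearMap.det_toMatrix b, ← Polynomial.coe_evalRingHom,
      RingHom.map_det]
    congr 1
    ext i j
    simp [M, LinearMap.toMatrix_apply, Matrix.one_apply, Finsupp.single_apply, eq_comm, add_comm]
    split_ifs <;> simp [mul_comm]
  have hdeg : q.degree < (Finset.range (n + 1)).card := by
    refine lt_of_le_of_lt Polynomial.degree_le_natDegree ?_
    have := Polynomial.natDegree_det_X_add_C_le M (1 : Matrix (Fin n) (Fin n) ℝ)
    rw [Fintype.card_fin] at this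
    rw [Finset.card_range]
    exact_mod_cast Nat.lt_succ_of_le this
  have := congrArg (Polynomial.eval t)
    (Lagrange.eq_interpolate (s := Finset.range (n + 1)) (v := v) hv.injOn hdeg)
  rw [hq, Lagrange.interpolate_apply, Polynomial.eval_finsetSum] at this
  simpa [hq] using this

/-- For `s` in [0, t] a kernel vector of `1 + s • A` would be shorter than itself; the determinant
never vanishes and keeps its sign at `s = 0`. -/
theorem det_one_add_smul_pos {A : E →L[ℝ] E} {t : ℝ} (ht : 0 ≤ t) (h : t * ‖A‖ < 1) :
    0 < (1 + t • A).det := by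
  have hne : ∀ s ∈ Icc 0 t, (1 + s • A).det ≠ 0 := by
    intro s hs h0
    obtain ⟨w, hw, hw0⟩ := SetLike.exists_of_lt (LinearMap.bot_lt_ker_of_det_eq_zero h0)
    have hw0 : w ≠ 0 := by simpa using hw0
    have hw : w + s • A w = 0 := by simpa using hw
    have h1 : ‖w‖ = s * ‖A w‖ := by
      have := congrArg norm (eq_neg_of_add_eq_zero_left hw)
      rwa [norm_neg, norm_smul, Real.norm_of_nonneg hs.1] at this
    have h2 : s * ‖A w‖ ≤ t * ‖A‖ * ‖w‖ := by
      rw [mul_assoc]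
      exact mul_le_mul hs.2 (A.le_opNorm w) (norm_nonneg _) ht
    have h3 : t * ‖A‖ * ‖w‖ < 1 * ‖w‖ := by gcongr
    linarith
  have hc : ContinuousOn (fun s : ℝ => (1 + s • A).det) (Icc 0 t) :=
    (ContinuousLinearMap.continuous_det.comp (by fun_prop)).continuousOn
  by_contra! hle
  have := intermediate_value_Icc' ht hc
  obtain ⟨s, hs, hs0⟩ := this ⟨hle, by simp [ContinuousLinearMap.det]⟩
  exact hne s hs hs0

end Determinant

section NoRetraction

/-- A segment leaving the ball crosses the sphere, where `u` already vanishes, so only its inner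
part counts. -/
theorem LipschitzOnWith.lipschitzWith_of_eq_zero {E : Type*} [NormedAddCommGroup E]
    [NormedSpace ℝ E] {u : E → E} {K : NNReal} (hu : LipschitzOnWith K u (closedBall 0 1))
    (h0 : ∀ x, 1 ≤ ‖x‖ → u x = 0) : LipschitzWith K u := by
  have key : ∀ x y : E, ‖x‖ ≤ 1 → 1 ≤ ‖y‖ → dist (u x) (u y) ≤ K * dist x y := by
    intro x y hx hy
    have hc : ContinuousOn (fun t : ℝ => ‖AffineMap.lineMap x y t‖) (Icc 0 1) := by
      refine Continuous.continuousOn ?_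
      exact (AffineMap.lineMap_continuous).norm
    obtain ⟨t, ht, ht1⟩ := intermediate_value_Icc zero_le_one hc ⟨by simpa, by simpa⟩
    simp only at ht1
    rw [h0 y hy, ← h0 _ ht1.ge]
    refine (hu.dist_le_mul x (by simpa using hx) _ (by simpa using ht1.le)).trans ?_
    gcongr
    rw [dist_left_lineMap, Real.norm_of_nonneg ht.1]
    exact mul_le_of_le_one_left dist_nonneg ht.2
  refine LipschitzWith.of_dist_le_mul fun x y => ?_
  rcases le_total ‖x‖ 1 with hx | hx <;> rcases le_total ‖y‖ 1 with hy | hy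
  · exact hu.dist_le_mul x (by simpa) y (by simpa)
  · exact key x y hx hy
  · rw [dist_comm, dist_comm x]; exact key y x hy hx
  · rw [h0 x hx, h0 y hy, dist_self]; positivity

variable {E : Type*} [NormedAddCommGroup E] [NormedSpace ℝ E] [FiniteDimensional ℝ E]

/-- Solving `x + t • u x = y` is a fixed point problem for a contraction, so the map is bijective on
`E`; being the identity off the ball, it preserves the ball. -/
theorem bijOn_ball_id_add_smul {u : E → E} {K : NNReal} (hu : LipschitzWith K u)
    (h0 : ∀ x, 1 ≤ ‖x‖ → u x = 0) {t : ℝ} (ht : 0 ≤ t) (htK : t * K < 1) :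
    BijOn (fun x => x + t • u x) (ball 0 1) (ball 0 1) := by
  have hinj : Function.Injective (fun x => x + t • u x) := by
    intro x y hxy
    have h1 : x - y = t • (u y - u x) := by
      simp only at hxy
      rw [smul_sub, sub_eq_sub_iff_add_eq_add, hxy, add_comm]
    have h2 : dist x y ≤ t * K * dist x y := by
      nth_rw 1 [dist_eq_norm, h1]
      rw [norm_smul, Real.norm_of_nonneg ht, ← dist_eq_norm, dist_comm x y, mul_assoc]
      exact mul_le_mul_of_nonneg_left (hu.dist_le_mul _ _) ht
    by_contra hne
    have : 0 < dist x y := dist_pos.2 hne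
    nlinarith
  have hsurj : Function.Surjective (fun x => x + t • u x) := by
    intro y
    have hc : ContractingWith (t.toNNReal * K) (fun x => y - t • u x) := by
      refine ⟨?_, LipschitzWith.of_dist_le_mul fun a b => ?_⟩
      · rw [← NNReal.coe_lt_coe]
        simpa [Real.coe_toNNReal _ ht] using htK
      · rw [dist_sub_left, dist_smul₀, Real.norm_of_nonneg ht]
        simp only [NNReal.coe_mul, Real.coe_toNNReal _ ht, mul_assoc]
        exact mul_le_mul_of_nonneg_left (hu.dist_le_mul _ _) ht
    refine ⟨hc.fixedPoint _, ?_⟩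
    have : y - t • u (hc.fixedPoint _) = hc.fixedPoint _ := hc.fixedPoint_isFixedPt
    simp only
    nth_rw 1 [← this]
    simp
  have hout : ∀ x, 1 ≤ ‖x‖ → x + t • u x = x := fun x hx => by simp [h0 x hx]
  refine ⟨fun x hx => ?_, hinj.injOn, fun y hy => ?_⟩
  · by_contra hx'
    have h1 : 1 ≤ ‖x + t • u x‖ := by simpa using hx'
    have := hinj (hout _ h1)
    simp only at this
    rw [this] at h1
    simp only [mem_ball, dist_zero_right] at hx
    linarith
  · obtain ⟨x, rfl⟩ := hsurj y
    refine ⟨x, ?_, rfl⟩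
    by_contra hx'
    have h1 : 1 ≤ ‖x‖ := by simpa using hx'
    simp only [hout x h1] at hy
    exact hx' hy

/-- The degree of a perturbation of the identity with support in the unit ball is one. -/
theorem integral_det_one_add_eq [MeasurableSpace E] [BorelSpace E] (μ : Measure E)
    [μ.IsAddHaarMeasure] {u : E → E} {K : NNReal} (hu : LipschitzWith K u)
    (h0 : ∀ x, 1 ≤ ‖x‖ → u x = 0) (hd : ∀ x ∈ ball (0 : E) 1, DifferentiableAt ℝ u x) :
    ∫ x in ball 0 1, (1 + fderiv ℝ u x).det ∂μ = μ.real (ball 0 1) := by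
  -- Distinct nodes with `v i * K < 1`: at each of them the perturbed identity is a bijection of the
  -- ball with positive Jacobian.
  let v : ℕ → ℝ := fun i => ((i + 1) * (K + 1) : ℝ)⁻¹
  have hv : Function.Injective v := by
    intro i j hij
    have hK : (K + 1 : ℝ) ≠ 0 := by positivity
    simpa [v, hK] using hij
  have hv0 : ∀ i, 0 ≤ v i := fun i => by positivity
  have hvK : ∀ i, v i * K < 1 := by
    intro i
    rw [inv_mul_lt_iff₀ (by positivity)]
    have : (0 : ℝ) ≤ K := K.2
    have : (0 : ℝ) ≤ i * (K + 1) := by positivity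
    linarith
  have hderiv : ∀ i, ∀ x ∈ ball (0 : E) 1,
      HasFDerivWithinAt (fun x => x + v i • u x) (1 + v i • fderiv ℝ u x) (ball 0 1) x :=
    fun i x hx => ((hasFDerivAt_id x).add
      ((hd x hx).hasFDerivAt.const_smul (v i))).hasFDerivWithinAt
  have hbij := fun i => bijOn_ball_id_add_smul hu h0 (hv0 i) (hvK i)
  have hpos : ∀ i x, 0 < (1 + v i • fderiv ℝ u x).det := fun i x =>
    det_one_add_smul_pos (hv0 i) (lt_of_le_of_lt
      (mul_le_mul_of_nonneg_left (norm_fderiv_le_of_lipschitz ℝ hu) (hv0 i)) (hvK i))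
  have hint : ∀ i, IntegrableOn (fun x => (1 + v i • fderiv ℝ u x).det) (ball 0 1) μ := by
    intro i
    have := (integrableOn_image_iff_integrableOn_abs_det_fderiv_smul μ measurableSet_ball
      (hderiv i) (hbij i).injOn (fun _ => (1 : ℝ))).1
        (by rw [(hbij i).image_eq]; exact integrableOn_const measure_ball_lt_top.ne)
    simpa [abs_of_pos (hpos i _)] using this
  have hval : ∀ i, ∫ x in ball 0 1, (1 + v i • fderiv ℝ u x).det ∂μ = μ.real (ball 0 1) := by
    intro i
    have := integral_image_eq_integral_abs_det_fderiv_smul μ measurableSet_ball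
      (hderiv i) (hbij i).injOn (fun _ => (1 : ℝ))
    rw [(hbij i).image_eq] at this
    simpa [abs_of_pos (hpos i _)] using this.symm
  -- The integral is the volume of the ball at every node, and Lagrange basis polynomials sum to
  -- one, so it is the volume at 1 as well.
  have hsum : ∀ x, (1 + fderiv ℝ u x).det = _ := fun x => by
    simpa using det_one_add_smul_eq_sum_lagrange (fderiv ℝ u x) hv 1
  simp_rw [hsum]
  rw [integral_finsetSum _ fun i _ => (hint i).mul_const _]
  simp_rw [integral_mul_const, hval]
  rw [← Finset.mul_sum, ← Polynomial.eval_finsetSum, Lagrange.sum_basis hv.injOn (by simp)]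
  simp

end NoRetraction

section Retraction

variable {E : Type*} [NormedAddCommGroup E] [InnerProductSpace ℝ E] [FiniteDimensional ℝ E]

/-- There is no continuously differentiable retraction of the closed ball onto the sphere. -/
theorem no_contDiff_retraction {r : E → E} (hr : ∀ x ∈ closedBall (0 : E) 1, ContDiffAt ℝ 1 r x)
    (hid : ∀ x ∈ sphere (0 : E) 1, r x = x) (hn : ∀ x ∈ closedBall (0 : E) 1, ‖r x‖ = 1) :
    False := by
  classical
  borelize E
  let u : E → E := fun x => if ‖x‖ ≤ 1 then r x - x else 0
  have hu0 : ∀ x, 1 ≤ ‖x‖ → u x = 0 := by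
    intro x hx
    by_cases h : ‖x‖ ≤ 1
    · simp [u, h, hid x (by simpa using le_antisymm h hx)]
    · simp [u, h]
  have hloc : LocallyLipschitzOn (closedBall (0 : E) 1) r := by
    intro x hx
    obtain ⟨K, t, ht, hK⟩ := (hr x hx).exists_lipschitzOnWith
    exact ⟨K, t, mem_nhdsWithin_of_mem_nhds ht, hK⟩
  obtain ⟨K, hK⟩ := hloc.exists_lipschitzOnWith_of_compact (isCompact_closedBall 0 1)
  have hK' : LipschitzOnWith (K + 1) u (closedBall 0 1) := by
    refine LipschitzOnWith.of_dist_le_mul fun x hx y hy => ?_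
    have h1 := hK.dist_le_mul x hx y hy
    rw [mem_closedBall_zero_iff] at hx hy
    simp only [u, hx, hy, if_true, NNReal.coe_add, NNReal.coe_one, add_mul, one_mul]
    refine (dist_sub_sub_le _ _ _ _).trans ?_
    linarith
  have hlip := hK'.lipschitzWith_of_eq_zero hu0
  have hnear : ∀ x ∈ ball (0 : E) 1, u =ᶠ[𝓝 x] fun x => r x - x := by
    intro x hx
    filter_upwards [isOpen_ball.mem_nhds hx] with y hy
    simp [u, (mem_ball_zero_iff.1 hy).le]
  have hr' : ∀ x ∈ ball (0 : E) 1, HasFDerivAt r (fderiv ℝ r x) x := fun x hx =>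
    ((hr x (ball_subset_closedBall hx)).differentiableAt one_ne_zero).hasFDerivAt
  have hder : ∀ x ∈ ball (0 : E) 1, HasFDerivAt u (fderiv ℝ r x - 1) x := fun x hx =>
    ((hr' x hx).sub (hasFDerivAt_id x)).congr_of_eventuallyEq (hnear x hx)
  -- Since `‖r‖ ^ 2` is constant, `r x` is orthogonal to the range of the derivative; if the
  -- derivative were onto, `r x` would be orthogonal to itself.
  have hdet : ∀ x ∈ ball (0 : E) 1, (1 + fderiv ℝ u x).det = 0 := by
    intro x hx
    rw [(hder x hx).fderiv, add_sub_cancel]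
    by_contra hne
    have hunit : IsUnit (fderiv ℝ r x : E →ₗ[ℝ] E) :=
      (LinearMap.isUnit_iff_isUnit_det _).2 (isUnit_iff_ne_zero.2 hne)
    obtain ⟨w, hw⟩ := ((Module.End.isUnit_iff _).1 hunit).2 (r x)
    have h1 : HasFDerivAt (fun y => ‖r y‖ ^ 2) (0 : E →L[ℝ] ℝ) x := by
      refine (hasFDerivAt_const (1 : ℝ) x).congr_of_eventuallyEq ?_
      filter_upwards [isOpen_ball.mem_nhds hx] with y hy
      simp [hn y (ball_subset_closedBall hy)]
    have h2 := congrArg (fun L => L w) (h1.unique (hr' x hx).norm_sq)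
    have hw' : fderiv ℝ r x w = r x := hw
    simp [hw', hn x (ball_subset_closedBall hx)] at h2
  have := integral_det_one_add_eq Measure.addHaar hlip hu0
    fun x hx => (hder x hx).differentiableAt
  rw [setIntegral_congr_fun measurableSet_ball hdet] at this
  simp only [integral_zero] at this
  exact (ENNReal.toReal_pos (measure_ball_pos _ _ one_pos).ne' measure_ball_lt_top.ne).ne this

/-- A continuous vector field on the closed ball at distance at most one from the identity has
a zero. -/
theorem exists_zero_of_norm_sub_le {g : E → E} (hg : ContinuousOn g (closedBall 0 1))
    (h : ∀ x ∈ closedBall (0 : E) 1, ‖g x - x‖ ≤ 1) : ∃ x ∈ closedBall (0 : E) 1, g x = 0 := by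
  by_contra! hne
  obtain ⟨δ, hδ, hgδ⟩ : ∃ δ > 0, ∀ x ∈ closedBall (0 : E) 1, δ ≤ ‖g x‖ := by
    obtain ⟨x, hx, hmin⟩ := (isCompact_closedBall (0 : E) 1).exists_isMinOn
      ⟨0, by simp⟩ hg.norm
    exact ⟨‖g x‖, norm_pos_iff.2 (hne x hx), fun y hy => hmin hy⟩
  let π : E → E := fun x => (max 1 ‖x‖)⁻¹ • x
  have hπc : Continuous π :=
    ((continuous_const.max continuous_norm).inv₀
      fun x => (lt_of_lt_of_le one_pos (le_max_left _ _)).ne').smul continuous_id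
  have hπm : ∀ x, π x ∈ closedBall (0 : E) 1 := fun x => by
    rw [mem_closedBall_zero_iff, norm_smul, Real.norm_of_nonneg (by positivity),
      inv_mul_le_iff₀ (by positivity)]
    simp
  have hg' : Continuous (g ∘ π) := hg.comp_continuous hπc hπm
  -- The bound δ keeps `p` from vanishing on the ball; δ²/2 keeps `p` pointing outwards beyond it,
  -- because `‖g θ - θ‖ ≤ 1` and `‖g θ‖ ≥ δ` give ⟨g θ, θ⟩ ≥ δ²/2 on the unit sphere.
  obtain ⟨p, hp, hpg, -⟩ := hg'.exists_contDiff_approx (ε := fun _ => min δ (δ ^ 2 / 2)) 1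
    continuous_const (fun _ => by positivity)
  let φ : ContDiffBump (0 : E) := ⟨1, 2, one_pos, one_lt_two⟩
  -- A C¹ field interpolating between `p` on the unit ball and the identity on the sphere of radius
  -- 2. Both terms point outwards in the shell, so normalising `F` gives a forbidden retraction.
  let F : E → E := fun x => φ x • p x + (1 - φ x) • x
  have hF : ContDiff ℝ 1 F :=
    (φ.contDiff.smul hp).add ((contDiff_const.sub φ.contDiff).smul contDiff_id)
  have hF0 : ∀ x, ‖x‖ ≤ 2 → F x ≠ 0 := by
    intro x hx h0
    rcases le_total ‖x‖ 1 with h1 | h1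
    · have hφ : φ x = 1 := φ.one_of_mem_closedBall (by simpa using h1)
      have hpx : p x = 0 := by simpa [F, hφ] using h0
      have h2 := hpg x
      have h3 : π x = x := by simp [π, max_eq_left h1]
      rw [hpx, Function.comp_apply, h3, dist_zero_left, lt_min_iff] at h2
      exact absurd h2.1 (not_lt.2 (hgδ x (by simpa using h1)))
    · have hx0 : (0 : ℝ) < ‖x‖ := by linarith
      set θ : E := π x with hθ
      have hxθ : x = ‖x‖ • θ := by
        rw [hθ]; simp only [π, max_eq_right h1]; rw [smul_smul, mul_inv_cancel₀ hx0.ne', one_smul]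
      have hθn : ‖θ‖ = 1 := by
        simp only [hθ, π, max_eq_right h1]
        rw [norm_smul, norm_inv, norm_norm, inv_mul_cancel₀ hx0.ne']
      have hθm := hπm x
      have h2 : δ ^ 2 / 2 ≤ inner ℝ (g θ) θ := by
        have ha := h θ hθm
        have hb := hgδ θ hθm
        have hc : ‖g θ - θ‖ ^ 2 ≤ 1 := pow_le_one₀ (norm_nonneg _) ha
        rw [norm_sub_sq_real, hθn] at hc
        have hd : δ ^ 2 ≤ ‖g θ‖ ^ 2 := by gcongr
        linarith
      have h3 : 0 < inner ℝ (p x) θ := by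
        have ha : ‖p x - g θ‖ < δ ^ 2 / 2 := by
          rw [← dist_eq_norm]; exact (hpg x).trans_le (min_le_right _ _)
        have hb : |inner ℝ (p x - g θ) θ| ≤ ‖p x - g θ‖ := by
          simpa [hθn] using abs_real_inner_le_norm (p x - g θ) θ
        rw [inner_sub_left] at hb
        have := (abs_le.1 hb).1
        linarith
      have h4 : φ x * inner ℝ (p x) θ + (1 - φ x) * ‖x‖ = 0 := by
        have := congrArg (fun z => inner ℝ z θ) h0
        simp only [F, inner_add_left, inner_smul_left, inner_zero_left] at this
        have hxin : inner ℝ x θ = ‖x‖ := by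
          nth_rw 1 [hxθ]
          rw [inner_smul_left, real_inner_self_eq_norm_sq, hθn]; simp
        simpa [hxin] using this
      have h5 := φ.nonneg (x := x)
      have h6 := φ.le_one (x := x)
      rcases h5.eq_or_lt with h7 | h7
      · rw [← h7] at h4; simp at h4; simp [h4] at hx0
      · have := mul_pos h7 h3
        have := mul_nonneg (sub_nonneg.2 h6) hx0.le
        linarith
  have hF2 : ∀ x, ‖x‖ = 2 → F x = x := by
    intro x hx
    have : φ x = 0 := φ.zero_of_le_dist (by simp [hx, φ])
    simp [F, this]
  refine no_contDiff_retraction (r := fun x => ‖F ((2 : ℝ) • x)‖⁻¹ • F ((2 : ℝ) • x)) ?_ ?_ ?_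
  · intro x hx
    have h0 := hF0 ((2 : ℝ) • x) (by rw [norm_smul]; simp at hx ⊢; linarith)
    have hc : ContDiffAt ℝ 1 (fun x : E => F ((2 : ℝ) • x)) x :=
      (hF.comp (contDiff_const_smul _)).contDiffAt
    exact ((hc.norm ℝ h0).inv (norm_ne_zero_iff.2 h0)).smul hc
  · intro x hx
    have hx : ‖x‖ = 1 := by simpa using hx
    have h2 : ‖(2 : ℝ) • x‖ = 2 := by rw [norm_smul, hx]; simp
    simp only [hF2 _ h2, h2, smul_smul]
    norm_num
  · intro x hx
    have h0 := hF0 ((2 : ℝ) • x) (by rw [norm_smul]; simp at hx ⊢; linarith)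
    rw [norm_smul, norm_inv, norm_norm, inv_mul_cancel₀ (norm_ne_zero_iff.2 h0)]

end Retraction

theorem ContinuousOn.continuousOn_invFunOn_image {X Y : Type*} [TopologicalSpace X]
    [TopologicalSpace Y] [T2Space Y] [Nonempty X] {f : X → Y} {s : Set X} (hs : IsCompact s)
    (hf : ContinuousOn f s) (hinj : InjOn f s) :
    ContinuousOn (Function.invFunOn f s) (f '' s) := by
  rw [continuousOn_iff_isClosed]
  refine fun t ht => ⟨f '' (t ∩ s), ?_, ?_⟩
  · exact ((hs.inter_left ht).image_of_continuousOn (hf.mono inter_subset_right)).isClosed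
  · ext y
    constructor
    · rintro ⟨hy, x, hx, rfl⟩
      rw [mem_preimage, hinj.leftInvOn_invFunOn hx] at hy
      exact ⟨⟨x, ⟨hy, hx⟩, rfl⟩, x, hx, rfl⟩
    · rintro ⟨⟨x, ⟨hxt, hx⟩, rfl⟩, -⟩
      refine ⟨?_, x, hx, rfl⟩
      rwa [mem_preimage, hinj.leftInvOn_invFunOn hx]

/-- Let `G` extend the inverse of `f` to the whole space. If `f 0` were not interior, the image
could be pushed away from a nearby missing point `c`, and a small C¹ perturbation of `G` would have
no zero on the pushed image. Composed with the push and `f`, it gives a zero-free field close to the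
identity, against `exists_zero_of_norm_sub_le`. -/
theorem mem_interior_image_closedBall {E : Type*} [NormedAddCommGroup E] [InnerProductSpace ℝ E]
    [FiniteDimensional ℝ E] {f : E → E} (hf : ContinuousOn f (closedBall 0 1))
    (hinj : InjOn f (closedBall 0 1)) : f 0 ∈ interior (f '' closedBall 0 1) := by
  classical
  borelize E
  set K := f '' closedBall (0 : E) 1 with hK
  have hKc : IsCompact K := (isCompact_closedBall 0 1).image_of_continuousOn hf
  have hinv := hf.continuousOn_invFunOn_image (isCompact_closedBall 0 1) hinj
  obtain ⟨G, hG⟩ := ContinuousMap.exists_restrict_eq hKc.isClosed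
    (⟨K.domRestrict (Function.invFunOn f (closedBall (0 : E) 1)), hinv.domRestrict⟩ : C(K, E))
  have hGf : ∀ x ∈ closedBall (0 : E) 1, G (f x) = x := by
    intro x hx
    have := congrArg (fun g : C(K, E) => g ⟨f x, mem_image_of_mem f hx⟩) hG
    exact this.trans (hinj.leftInvOn_invFunOn hx)
  have h0m : (0 : E) ∈ closedBall (0 : E) 1 := by simp
  by_contra hnot
  obtain ⟨ρ, hρ, hGρ⟩ := Metric.continuousAt_iff.1 (G.continuous.continuousAt (x := f 0)) (1 / 10)
    (by norm_num)
  rw [hGf 0 h0m] at hGρ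
  obtain ⟨ε, hε, hερ⟩ : ∃ ε > 0, 2 * ε < ρ := ⟨ρ / 3, by positivity, by linarith⟩
  have hGε : ∀ y, dist y (f 0) ≤ 2 * ε → ‖G y‖ ≤ 1 / 10 := fun y hy => by
    simpa using (hGρ (hy.trans_lt hερ)).le
  obtain ⟨c, hcε, hcK⟩ : ∃ c, dist c (f 0) < ε ∧ c ∉ K := by
    by_contra! h
    exact hnot (mem_interior.2 ⟨ball (f 0) ε, fun y hy => h y hy, isOpen_ball, mem_ball_self hε⟩)
  -- The radial push from `c`: points nearer than ε go to the sphere, the others stay.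
  let Φ : E → E := fun y => c + max (ε / ‖y - c‖) 1 • (y - c)
  have hyc : ∀ y ∈ K, 0 < ‖y - c‖ := fun y hy => by
    rw [norm_pos_iff, sub_ne_zero]; rintro rfl; exact hcK hy
  have hΦc : ContinuousOn Φ K := by
    have h1 : ContinuousOn (fun y => ‖y - c‖) K := by fun_prop
    exact continuousOn_const.add (((continuousOn_const.div h1 fun y hy => (hyc y hy).ne').sup
      continuousOn_const).smul (by fun_prop))
  have hΦ1 : ∀ y ∈ K, ε ≤ ‖y - c‖ → Φ y = y := fun y hy h => by
    have : ε / ‖y - c‖ ≤ 1 := (div_le_one (hyc y hy)).2 h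
    simp [Φ, max_eq_right this]
  have hΦ2 : ∀ y ∈ K, ‖y - c‖ < ε → Φ y ∈ sphere c ε := fun y hy h => by
    have : 1 ≤ ε / ‖y - c‖ := (one_le_div (hyc y hy)).2 h.le
    rw [mem_sphere_iff_norm]
    simp only [Φ, max_eq_left this, add_sub_cancel_left]
    rw [norm_smul, Real.norm_of_nonneg (by positivity), div_mul_cancel₀ _ (hyc y hy).ne']
  -- On `K` the only zero of `G` is `f 0`, which is within ε of `c`. The cap 1/10 leaves room in the
  -- last estimate.
  obtain ⟨δ, hδ, hδ1, hGδ⟩ : ∃ δ > 0, δ ≤ 1 / 10 ∧ ∀ y ∈ K, ε ≤ ‖y - c‖ → δ ≤ ‖G y‖ := by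
    have hc : IsCompact (K ∩ {y | ε ≤ ‖y - c‖}) :=
      hKc.inter_right (isClosed_le continuous_const (by fun_prop))
    rcases (K ∩ {y | ε ≤ ‖y - c‖}).eq_empty_or_nonempty with he | hne
    · refine ⟨1 / 10, by norm_num, le_rfl, fun y hy h => ?_⟩
      exact absurd (he ▸ ⟨hy, h⟩ : y ∈ (∅ : Set E)) (notMem_empty y)
    · obtain ⟨y, ⟨hy, hyε⟩, hmin⟩ := hc.exists_isMinOn hne G.continuous.norm.continuousOn
      refine ⟨min ‖G y‖ (1 / 10), lt_min (norm_pos_iff.2 ?_) (by norm_num), min_le_right _ _,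
        fun z hz h => (min_le_left _ _).trans (hmin ⟨hz, h⟩)⟩
      obtain ⟨x, hx, rfl⟩ := hy
      rw [hGf x hx]
      rintro rfl
      rw [mem_ofPred_eq, ← dist_eq_norm, dist_comm] at hyε
      linarith
  obtain ⟨P, hP, hPG, -⟩ := G.continuous.exists_contDiff_approx (ε := fun _ => δ / 2) 1
    continuous_const (fun _ => by positivity)
  have hnull : Measure.addHaar (P '' sphere c ε) = 0 :=
    addHaar_image_eq_zero_of_differentiableOn_of_addHaar_eq_zero _
      (hP.differentiable one_ne_zero).differentiableOn
      (Measure.addHaar_sphere_of_ne_zero _ c hε.ne')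
  -- The sphere is null and `P` is C¹, so a small generic `w` is missed: `P - w` has no zero on the
  -- sphere.
  obtain ⟨w, hwP, hw⟩ : ∃ w, w ∉ P '' sphere c ε ∧ ‖w‖ < δ / 2 := by
    by_contra! h
    have hsub : ball (0 : E) (δ / 2) ⊆ P '' sphere c ε := fun w hw => by
      by_contra hw'
      exact absurd (h w hw') (not_le.2 (by simpa using hw))
    exact (measure_ball_pos (Measure.addHaar (G := E)) (0 : E) (half_pos hδ)).ne'
      (measure_mono_null hsub hnull)
  have hPG' : ∀ y, ‖P y - w - G y‖ < δ := fun y => by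
    have h1 := hPG y
    rw [dist_eq_norm] at h1
    calc ‖P y - w - G y‖ = ‖(P y - G y) - w‖ := by congr 1; abel
      _ ≤ ‖P y - G y‖ + ‖w‖ := norm_sub_le _ _
      _ < δ := by linarith
  obtain ⟨x, hx, hx0⟩ := exists_zero_of_norm_sub_le (g := fun x => P (Φ (f x)) - w)
    ((hP.continuous.comp_continuousOn (hΦc.comp hf (mapsTo_image f _))).sub continuousOn_const) (by
      intro x hx
      have hfx : f x ∈ K := mem_image_of_mem f hx
      rcases le_or_gt ε ‖f x - c‖ with h | h
      · rw [hΦ1 _ hfx h]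
        have := hPG' (f x)
        rw [hGf x hx] at this
        linarith
      · have h1 : dist (f x) (f 0) ≤ 2 * ε := by
          have := dist_triangle (f x) c (f 0)
          rw [dist_eq_norm (f x) c] at this
          linarith
        have h2 : dist (Φ (f x)) (f 0) ≤ 2 * ε := by
          have := dist_triangle (Φ (f x)) c (f 0)
          rw [mem_sphere.1 (hΦ2 _ hfx h)] at this
          linarith
        have h3 := hGε _ h1
        have h4 := hGε _ h2
        rw [hGf x hx] at h3
        have h5 := hPG' (Φ (f x))
        calc ‖P (Φ (f x)) - w - x‖
            = ‖(P (Φ (f x)) - w - G (Φ (f x))) + (G (Φ (f x)) - x)‖ := by congr 1; abel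
          _ ≤ ‖P (Φ (f x)) - w - G (Φ (f x))‖ + (‖G (Φ (f x))‖ + ‖x‖) :=
            (norm_add_le _ _).trans (by gcongr; exact norm_sub_le _ _)
          _ ≤ 1 := by linarith)
  have hfx : f x ∈ K := mem_image_of_mem f hx
  rcases le_or_gt ε ‖f x - c‖ with h | h
  · have h1 := hPG' (f x)
    rw [hΦ1 _ hfx h] at hx0
    rw [hx0, zero_sub, norm_neg] at h1
    exact absurd (hGδ _ hfx h) (not_le.2 h1)
  · exact hwP ⟨_, hΦ2 _ hfx h, sub_eq_zero.1 hx0⟩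

/-- **Invariance of domain**. -/
theorem isOpen_image_of_continuousOn_of_injOn {E : Type*} [NormedAddCommGroup E] [NormedSpace ℝ E]
    [FiniteDimensional ℝ E] {f : E → E} {U : Set E} (hU : IsOpen U) (hf : ContinuousOn f U)
    (hinj : InjOn f U) : IsOpen (f '' U) := by
  -- The local result uses an inner product, which a linear equivalence supplies.
  let L : E ≃L[ℝ] EuclideanSpace ℝ (Fin (Module.finrank ℝ E)) :=
    ContinuousLinearEquiv.ofFinrankEq (by simp)
  rw [isOpen_iff_mem_nhds]
  rintro _ ⟨x, hx, rfl⟩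
  let a : EuclideanSpace ℝ (Fin (Module.finrank ℝ E)) → E := fun v => x + L.symm v
  have ha : Continuous a := by fun_prop
  have ha' : Function.Injective a := fun v w h => L.symm.injective (add_left_cancel h)
  have hmem : a ⁻¹' U ∈ 𝓝 0 := ha.continuousAt.preimage_mem_nhds (hU.mem_nhds (by simpa [a]))
  obtain ⟨r, hr, hrU⟩ := nhds_basis_closedBall.mem_iff.1 hmem
  have hmaps : MapsTo (fun v => a (r • v)) (closedBall 0 1) U := by
    intro v hv
    refine hrU ?_
    rw [mem_closedBall_zero_iff, norm_smul, Real.norm_of_nonneg hr.le] at *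
    exact mul_le_of_le_one_right hr.le hv
  have hin : Function.Injective fun v => a (r • v) := fun v w h =>
    smul_right_injective _ hr.ne' (ha' h)
  have key := mem_interior_image_closedBall (f := fun v => L (f (a (r • v))))
    (L.continuous.comp_continuousOn (hf.comp (by fun_prop) hmaps))
    (L.injective.comp_injOn (hinj.comp hin.injOn hmaps))
  have hs : (fun v => L (f (a (r • v)))) '' closedBall 0 1 ⊆ L '' (f '' U) := by
    rintro _ ⟨v, hv, rfl⟩
    exact mem_image_of_mem _ (mem_image_of_mem _ (hmaps hv))
  have h1 := mem_interior_iff_mem_nhds.1 (interior_mono hs key)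
  have h2 := L.continuous.continuousAt.preimage_mem_nhds (x := f x) (by simpa [a] using h1)
  rwa [preimage_image_eq _ L.injective] at h2

end InvarianceOfDomain

/-! ### Invariance of domain on the sphere of the sup norm. -/

section Sphere

variable {k : ℕ}

/-- Near `p` with `p i ≠ 0`, normalising the hyperplane of points with `i`-th coordinate `p i`
parametrises the sphere; injectivity holds because that coordinate reveals the scaling factor.
Invariance of domain applies in this chart. -/
theorem isOpen_image_inter_sphere {O : Set (Fin (k + 1) → ℝ)} (hO : IsOpen O)
    {g : (Fin (k + 1) → ℝ) → Fin k → ℝ} (hg : ContinuousOn g (O ∩ sphere 0 1))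
    (hinj : InjOn g (O ∩ sphere 0 1)) : IsOpen (g '' (O ∩ sphere 0 1)) := by
  rw [isOpen_iff_mem_nhds]
  rintro _ ⟨p, ⟨hpO, hp⟩, rfl⟩
  have hp1 : ‖p‖ = 1 := by simpa using hp
  obtain ⟨i, hi⟩ : ∃ i, p i ≠ 0 := by
    by_contra! h
    have : p = 0 := funext h
    simp [this] at hp1
  let q : (Fin k → ℝ) → Fin (k + 1) → ℝ := fun v => i.insertNth (p i) v
  have hqc : Continuous q := continuous_const.finInsertNth i continuous_id
  have hqi : ∀ v, q v i = p i := fun v => by simp [q]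
  have hq0 : ∀ v, 0 < ‖q v‖ := fun v => norm_pos_iff.2 fun h => hi (by rw [← hqi v, h]; rfl)
  let N : (Fin k → ℝ) → Fin (k + 1) → ℝ := fun v => ‖q v‖⁻¹ • q v
  have hNc : Continuous N := (hqc.norm.inv₀ fun v => (hq0 v).ne').smul hqc
  have hNs : ∀ v, N v ∈ sphere (0 : Fin (k + 1) → ℝ) 1 := fun v => by
    rw [mem_sphere_zero_iff_norm, norm_smul, norm_inv, norm_norm, inv_mul_cancel₀ (hq0 v).ne']
  have hNi : Function.Injective N := by
    intro v w h
    have h1 : ‖q v‖⁻¹ = ‖q w‖⁻¹ := by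
      have := congrFun h i
      simp only [N, Pi.smul_apply, hqi, smul_eq_mul] at this
      exact mul_right_cancel₀ hi this
    simp only [N, h1] at h
    have h2 : q v = q w := smul_right_injective _ (inv_ne_zero (hq0 w).ne') h
    exact funext fun l => by simpa [q] using congrFun h2 (i.succAbove l)
  have hNp : N (i.removeNth p) = p := by simp [N, q, hp1]
  have hmaps : MapsTo N (N ⁻¹' O) (O ∩ sphere 0 1) := fun v hv => ⟨hv, hNs v⟩
  have := isOpen_image_of_continuousOn_of_injOn (hO.preimage hNc)
    (hg.comp hNc.continuousOn hmaps) (hinj.comp hNi.injOn hmaps)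
  refine Filter.mem_of_superset (this.mem_nhds ⟨i.removeNth p, ?_, ?_⟩) ?_
  · simpa [hNp] using hpO
  · simp [hNp]
  · rintro _ ⟨v, hv, rfl⟩
    exact ⟨N v, hmaps hv, rfl⟩

/-- Padding with zeros would give a nonempty open image inside a coordinate hyperplane; a line
transverse to it yields the contradiction. -/
theorem not_injOn_inter_sphere {j : ℕ} (hj : j < k) {O : Set (Fin (k + 1) → ℝ)} (hO : IsOpen O)
    (hne : (O ∩ sphere 0 1).Nonempty)
    {g : (Fin (k + 1) → ℝ) → Fin j → ℝ} (hg : ContinuousOn g (O ∩ sphere 0 1)) :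
    ¬ InjOn g (O ∩ sphere 0 1) := by
  intro hinj
  let a : (Fin j → ℝ) → Fin k → ℝ := fun v i => if h : i.1 < j then v ⟨i, h⟩ else 0
  have ha : Continuous a := continuous_pi fun i => by
    by_cases h : i.1 < j
    · simpa [a, h] using continuous_apply _
    · simpa [a, h] using continuous_const
  have hai : Function.Injective a := fun v w h => funext fun i => by
    have := congrFun h ⟨i, i.2.trans hj⟩
    simpa [a] using this
  have hopen := isOpen_image_inter_sphere hO (ha.comp_continuousOn hg) (hai.comp_injOn hinj)
  obtain ⟨p, hp⟩ := hne
  let c : ℝ → Fin k → ℝ := fun t => Function.update (a (g p)) ⟨j, hj⟩ t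
  have hc : Continuous c := continuous_const.update _ continuous_id
  have hcj : ∀ v, a v ⟨j, hj⟩ = 0 := fun v => by simp [a]
  have hc0 : c 0 = a (g p) := by
    rw [← hcj (g p)]; exact Function.update_eq_self _ _
  have hsub : c ⁻¹' ((a ∘ g) '' (O ∩ sphere 0 1)) ⊆ {0} := by
    rintro t ⟨u, -, hu⟩
    have := congrFun hu ⟨j, hj⟩
    simpa [c, hcj] using this.symm
  have h1 : {(0 : ℝ)} ∈ 𝓝 (0 : ℝ) := Filter.mem_of_superset
    ((hopen.preimage hc).mem_nhds (by rw [mem_preimage, hc0]; exact ⟨p, hp, rfl⟩)) hsub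
  have h2 := (Filter.nonempty_of_mem (Filter.inter_mem (mem_nhdsWithin_of_mem_nhds h1)
    (self_mem_nhdsWithin (a := (0 : ℝ)) (s := {0}ᶜ))))
  obtain ⟨t, ht, ht'⟩ := h2
  exact ht' ht

end Sphere

/-! ### Frontiers of cells are unions of closed cells of codimension one. -/

namespace IsSimpleCWComplex

open CWComplex

variable {X : Type*} [TopologicalSpace X] [CWComplex (univ : Set X)]

theorem injOn_map (hX : IsSimpleCWComplex X) (n : ℕ) (e : cell (univ : Set X) n) :
    InjOn (map n e) (closedBall 0 1) := fun x hx y hy h =>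
  congrArg Subtype.val ((hX.isEmbedding n e).injective (a₁ := ⟨x, hx⟩) (a₂ := ⟨y, hy⟩) h)

theorem continuousOn_invFunOn_map [T2Space X] (hX : IsSimpleCWComplex X) (n : ℕ)
    (e : cell (univ : Set X) n) :
    ContinuousOn (Function.invFunOn (map n e) (closedBall 0 1)) (closedCell n e) :=
  (continuousOn n e).continuousOn_invFunOn_image (isCompact_closedBall _ _) (hX.injOn_map n e)

theorem finite_sigma_cell (hX : IsSimpleCWComplex X) : Finite (Σ n, cell (univ : Set X) n) :=
  haveI := hX.finite
  finite_cells_of_finite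

theorem finite_cell (hX : IsSimpleCWComplex X) (n : ℕ) : Finite (cell (univ : Set X) n) :=
  haveI := hX.finite_sigma_cell
  Finite.of_injective _ (sigma_mk_injective (i := n))

/-- The boundary sphere of `e` and the open cell `f` have the same dimension, so the part of `f`
covered by the frontier is open in `f`. It is also closed, and an open ball is connected. -/
theorem closedCell_subset_cellFrontier [T2Space X] (hX : IsSimpleCWComplex X) {k : ℕ}
    (e : cell (univ : Set X) (k + 1)) (f : cell (univ : Set X) k)
    (h : (openCell k f ∩ cellFrontier (k + 1) e).Nonempty) :
    closedCell k f ⊆ cellFrontier (k + 1) e := by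
  have := hX.finite_cell k
  have hSc : IsClosed (cellFrontier (k + 1) e) := isClosed_cellFrontier
  -- A closed set containing every cell of dimension at most `k` except `f`, whose complement cuts
  -- the frontier in points of the open cell `f` alone.
  let Z : Set X := (skeletonLT (univ : Set X) k : Set X) ∪ ⋃ f' : {f' // f' ≠ f}, closedCell k f'.1
  have hZ : IsClosed Z := (skeletonLT (univ : Set X) k).closed.union
    (isClosed_iUnion_of_finite fun _ => isClosed_closedCell)
  have hdisj : Disjoint (openCell k f) Z := by
    refine disjoint_union_right.2 ⟨(disjoint_skeletonLT_openCell le_rfl).symm, ?_⟩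
    refine disjoint_iUnion_right.2 fun f' => ?_
    rw [← cellFrontier_union_openCell_eq_closedCell]
    refine disjoint_union_right.2 ⟨?_, disjoint_openCell_of_ne fun h => f'.2 ?_⟩
    · exact (disjoint_skeletonLT_openCell le_rfl).symm.mono_right
        (cellFrontier_subset_skeletonLT k f'.1)
    · simpa using h.symm
  have hmem : ∀ x ∈ cellFrontier (k + 1) e, x ∉ Z → x ∈ openCell k f := by
    intro x hx hxZ
    have h1 := cellFrontier_subset_skeletonLT _ _ hx
    obtain ⟨m, hm, f', hf'⟩ := mem_skeletonLT_iff.1 h1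
    have hm : m < k + 1 := by exact_mod_cast hm
    rcases (Nat.lt_succ_iff.1 hm).lt_or_eq with hlt | rfl
    · exact absurd (Or.inl (mem_skeletonLT_iff.2 ⟨m, by exact_mod_cast hlt, f', hf'⟩)) hxZ
    · by_cases hff : f' = f
      · exact hff ▸ hf'
      · exact absurd (Or.inr (mem_iUnion_of_mem (⟨f', hff⟩ : {f' // f' ≠ f})
          (openCell_subset_closedCell _ _ hf'))) hxZ
  have hφ : ContinuousOn (map (k + 1) e) (sphere 0 1) :=
    (continuousOn (k + 1) e).mono sphere_subset_closedBall
  obtain ⟨O, hO, hOeq⟩ := continuousOn_iff'.1 hφ Zᶜ hZ.isOpen_compl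
  have hOmem : ∀ u ∈ O ∩ sphere 0 1, map (k + 1) e u ∈ openCell k f := by
    intro u hu
    refine hmem _ (mem_image_of_mem _ hu.2) ?_
    rw [← hOeq] at hu
    exact hu.1
  have hmemO : ∀ u ∈ sphere (0 : Fin (k + 1) → ℝ) 1, map (k + 1) e u ∈ openCell k f →
      u ∈ O ∩ sphere 0 1 := by
    intro u hu huf
    rw [← hOeq]
    exact ⟨fun hz => disjoint_left.1 hdisj huf hz, hu⟩
  let g := Function.invFunOn (map k f) (closedBall 0 1) ∘ map (k + 1) e
  have hgball : ∀ u ∈ O ∩ sphere 0 1, g u ∈ ball (0 : Fin k → ℝ) 1 ∧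
      map k f (g u) = map (k + 1) e u := by
    intro u hu
    obtain ⟨v, hv, hvu⟩ := hOmem u hu
    have : g u = v := by
      simp only [g, Function.comp_apply, ← hvu]
      exact (hX.injOn_map k f).leftInvOn_invFunOn (ball_subset_closedBall hv)
    rw [this]
    exact ⟨hv, hvu⟩
  have hopen : IsOpen (g '' (O ∩ sphere 0 1)) := by
    refine isOpen_image_inter_sphere hO ?_ ?_
    · exact (hX.continuousOn_invFunOn_map k f).comp (hφ.mono inter_subset_right)
        fun u hu => openCell_subset_closedCell _ _ (hOmem u hu)
    · intro u hu v hv huv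
      refine hX.injOn_map (k + 1) e (sphere_subset_closedBall hu.2)
        (sphere_subset_closedBall hv.2) ?_
      rw [← (hgball u hu).2, ← (hgball v hv).2, huv]
  have hsub : g '' (O ∩ sphere 0 1) ⊆
      closedBall 0 1 ∩ map k f ⁻¹' cellFrontier (k + 1) e := by
    rintro _ ⟨u, hu, rfl⟩
    refine ⟨ball_subset_closedBall (hgball u hu).1, ?_⟩
    rw [mem_preimage, (hgball u hu).2]
    exact mem_image_of_mem _ hu.2
  have hmem' : ∀ v ∈ ball (0 : Fin k → ℝ) 1, map k f v ∈ cellFrontier (k + 1) e →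
      v ∈ g '' (O ∩ sphere 0 1) := by
    rintro v hv ⟨u, hu, huv⟩
    have huO := hmemO u hu (huv ▸ mem_image_of_mem _ hv)
    refine ⟨u, huO, hX.injOn_map k f (ball_subset_closedBall (hgball u huO).1)
      (ball_subset_closedBall hv) ?_⟩
    rw [(hgball u huO).2, huv]
  have hball : ball (0 : Fin k → ℝ) 1 ⊆ g '' (O ∩ sphere 0 1) := by
    refine (convex_ball 0 1).isPreconnected.subset_of_closure_inter_subset hopen ?_ ?_
    · obtain ⟨_, ⟨v, hv, rfl⟩, hvS⟩ := h
      exact ⟨v, hv, hmem' v hv hvS⟩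
    · rintro v ⟨hv, hvb⟩
      have hcl := closure_minimal hsub
        ((continuousOn k f).preimage_isClosed_of_isClosed isClosed_closedBall hSc)
      exact hmem' v hvb (hcl hv).2
  rw [← closure_openCell_eq_closedCell]
  refine closure_minimal ?_ hSc
  rintro _ ⟨v, hv, rfl⟩
  exact (hsub (hball hv)).2

/-- Finite CW complexes whose characteristic maps are embeddings are normal: the frontier of a
cell of positive dimension is the union of the closed cells of codimension one it contains. -/
theorem exists_closedCell_subset_cellFrontier [T2Space X] (hX : IsSimpleCWComplex X) {k : ℕ}
    (e : cell (univ : Set X) (k + 1)) {x : X} (hx : x ∈ cellFrontier (k + 1) e) :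
    ∃ f : cell (univ : Set X) k, x ∈ closedCell k f ∧ closedCell k f ⊆ cellFrontier (k + 1) e := by
  have := hX.finite_cell k
  have := hX.finite_sigma_cell
  by_contra! hcon
  let Z : Set X := ⋃ f : {f : cell (univ : Set X) k // closedCell k f ⊆ cellFrontier (k + 1) e},
    closedCell k f.1
  have hZ : IsClosed Z := isClosed_iUnion_of_finite fun _ => isClosed_closedCell
  have hφ : ContinuousOn (map (k + 1) e) (sphere 0 1) :=
    (continuousOn (k + 1) e).mono sphere_subset_closedBall
  obtain ⟨O, hO, hOeq⟩ := continuousOn_iff'.1 hφ Zᶜ hZ.isOpen_compl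
  have hne : (O ∩ sphere 0 1).Nonempty := by
    obtain ⟨u, hu, rfl⟩ := hx
    refine ⟨u, ?_⟩
    rw [← hOeq]
    refine ⟨fun hz => ?_, hu⟩
    obtain ⟨f, hf⟩ := mem_iUnion.1 hz
    exact hcon f.1 hf f.2
  let W := (O ∩ sphere (0 : Fin (k + 1) → ℝ) 1 : Set (Fin (k + 1) → ℝ))
  have : LocallyCompactSpace W :=
    (hO.isLocallyClosed.inter isClosed_sphere.isLocallyClosed).locallyCompactSpace
  have : Nonempty W := hne.to_subtype
  let ι := {c : Σ n, cell (univ : Set X) n // c.1 < k}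
  let φW : W → X := fun u => map (k + 1) e u.1
  have hφW : Continuous φW := (hφ.mono inter_subset_right).domRestrict
  -- Off `Z` the frontier meets only cells of dimension below `k`, by the previous lemma. Baire puts
  -- an open piece of the `k`-sphere inside one such closed cell, hence injectively into a space of
  -- smaller dimension.
  obtain ⟨c, u, hu⟩ := nonempty_interior_of_iUnion_of_closed
    (f := fun c : ι => φW ⁻¹' closedCell c.1.1 c.1.2)
    (fun c => isClosed_closedCell.preimage hφW) (by
      refine eq_univ_of_forall fun u => mem_iUnion.2 ?_
      have huS : φW u ∈ cellFrontier (k + 1) e := mem_image_of_mem _ u.2.2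
      obtain ⟨m, hm, f, hf⟩ := mem_skeletonLT_iff.1 (cellFrontier_subset_skeletonLT _ _ huS)
      have hm : m < k + 1 := by exact_mod_cast hm
      rcases (Nat.lt_succ_iff.1 hm).lt_or_eq with hlt | rfl
      · exact ⟨⟨⟨m, f⟩, hlt⟩, openCell_subset_closedCell _ _ hf⟩
      · have h1 := hX.closedCell_subset_cellFrontier e f ⟨_, hf, huS⟩
        have h2 : u.1 ∈ _ ∩ _ := hOeq.symm.subset u.2
        exact (h2.1 (mem_iUnion_of_mem
          (⟨f, h1⟩ : {f : cell (univ : Set X) m // closedCell m f ⊆ cellFrontier (m + 1) e})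
          (openCell_subset_closedCell _ _ hf))).elim)
  obtain ⟨O', hO', hO'eq⟩ := isOpen_induced_iff.1
    (isOpen_interior (s := φW ⁻¹' closedCell c.1.1 c.1.2))
  have hmaps : MapsTo (map (k + 1) e) ((O' ∩ O) ∩ sphere 0 1) (closedCell c.1.1 c.1.2) := by
    rintro v ⟨⟨hvO', hvO⟩, hv⟩
    have : (⟨v, hvO, hv⟩ : W) ∈ interior (φW ⁻¹' closedCell c.1.1 c.1.2) := by
      rw [← hO'eq]; exact hvO'
    exact interior_subset (s := φW ⁻¹' closedCell c.1.1 c.1.2) this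
  refine not_injOn_inter_sphere c.2 (hO'.inter hO) ⟨u.1, ⟨?_, u.2.1⟩, u.2.2⟩
    (g := Function.invFunOn (map c.1.1 c.1.2) (closedBall 0 1) ∘ map (k + 1) e) ?_ ?_
  · rw [← hO'eq] at hu; exact hu
  · exact (hX.continuousOn_invFunOn_map c.1.1 c.1.2).comp (hφ.mono inter_subset_right) hmaps
  · intro v hv w hw hvw
    refine hX.injOn_map (k + 1) e (sphere_subset_closedBall hv.2)
      (sphere_subset_closedBall hw.2) ?_
    rw [← Function.invFunOn_eq (hmaps hv), ← Function.invFunOn_eq (hmaps hw)]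
    exact congrArg _ hvw

end IsSimpleCWComplex

/-! ### Barycentric subdivision by flags of cells. -/

namespace IsSimpleCWComplex

open CWComplex

variable {X : Type*} [TopologicalSpace X] [CWComplex (univ : Set X)]

/-- The homothety of ratio `r` of the closed cell `c` towards its centre. -/
noncomputable def cellShrink (c : Σ n, cell (univ : Set X) n) (r : ℝ) (x : X) : X :=
  map c.1 c.2 (r • Function.invFunOn (map c.1 c.2) (closedBall 0 1) x)

theorem cellShrink_zero (c : Σ n, cell (univ : Set X) n) (x : X) :
    cellShrink c 0 x = map c.1 c.2 0 := by
  simp [cellShrink]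

theorem cellShrink_one (c : Σ n, cell (univ : Set X) n) {x : X} (hx : x ∈ closedCell c.1 c.2) :
    cellShrink c 1 x = x := by
  rw [cellShrink, one_smul]
  exact Function.invFunOn_eq hx

theorem smul_invFunOn_mem_closedBall (c : Σ n, cell (univ : Set X) n) {x : X}
    (hx : x ∈ closedCell c.1 c.2) {r : ℝ} (hr : r ∈ Icc (0 : ℝ) 1) :
    r • Function.invFunOn (map c.1 c.2) (closedBall 0 1) x ∈ closedBall (0 : Fin c.1 → ℝ) 1 := by
  have h : _ ∈ closedBall (0 : Fin c.1 → ℝ) 1 := Function.invFunOn_mem hx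
  rw [mem_closedBall_zero_iff] at *
  rw [norm_smul, Real.norm_of_nonneg hr.1]
  exact mul_le_one₀ hr.2 (norm_nonneg _) h

theorem cellShrink_mem_closedCell (c : Σ n, cell (univ : Set X) n) {x : X}
    (hx : x ∈ closedCell c.1 c.2) {r : ℝ} (hr : r ∈ Icc (0 : ℝ) 1) :
    cellShrink c r x ∈ closedCell c.1 c.2 :=
  mem_image_of_mem _ (smul_invFunOn_mem_closedBall c hx hr)

theorem cellShrink_mem_openCell (c : Σ n, cell (univ : Set X) n) {x : X}
    (hx : x ∈ closedCell c.1 c.2) {r : ℝ} (hr : r ∈ Ico (0 : ℝ) 1) :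
    cellShrink c r x ∈ openCell c.1 c.2 := by
  refine mem_image_of_mem _ ?_
  have h : _ ∈ closedBall (0 : Fin c.1 → ℝ) 1 := Function.invFunOn_mem hx
  rw [mem_closedBall_zero_iff] at h
  rw [mem_ball_zero_iff, norm_smul, Real.norm_of_nonneg hr.1]
  nlinarith [hr.1, hr.2, norm_nonneg (Function.invFunOn (map c.1 c.2) (closedBall 0 1) x)]

/-- Polar coordinates: a closed cell is the cone over its frontier. Positive dimension ensures that
even the centre lies on a radius. -/
theorem exists_cellShrink_eq (hX : IsSimpleCWComplex X) {k : ℕ} (e : cell (univ : Set X) (k + 1))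
    {x : X} (hx : x ∈ closedCell (k + 1) e) :
    ∃ x' ∈ cellFrontier (k + 1) e, ∃ r ∈ Icc (0 : ℝ) 1, cellShrink ⟨k + 1, e⟩ r x' = x := by
  obtain ⟨u, hu, rfl⟩ := hx
  have hu : ‖u‖ ≤ 1 := by simpa using hu
  obtain ⟨θ, hθ, hθu⟩ : ∃ θ : Fin (k + 1) → ℝ, ‖θ‖ = 1 ∧ ‖u‖ • θ = u := by
    by_cases h0 : u = 0
    · exact ⟨1, by simp, by simp [h0]⟩
    · refine ⟨‖u‖⁻¹ • u, ?_, ?_⟩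
      · rw [norm_smul, norm_inv, norm_norm, inv_mul_cancel₀ (norm_ne_zero_iff.2 h0)]
      · rw [smul_smul, mul_inv_cancel₀ (norm_ne_zero_iff.2 h0), one_smul]
  refine ⟨map (k + 1) e θ, mem_image_of_mem _ (by simpa using hθ), ‖u‖, ⟨norm_nonneg _, hu⟩, ?_⟩
  rw [cellShrink, (hX.injOn_map (k + 1) e).leftInvOn_invFunOn (by simpa using hθ.le), hθu]

theorem cellShrink_eq_cellShrink (hX : IsSimpleCWComplex X) (c : Σ n, cell (univ : Set X) n)
    {x x' : X} (hx : x ∈ cellFrontier c.1 c.2) (hx' : x' ∈ cellFrontier c.1 c.2) {r r' : ℝ}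
    (hr : r ∈ Icc (0 : ℝ) 1) (hr' : r' ∈ Icc (0 : ℝ) 1)
    (h : cellShrink c r x = cellShrink c r' x') : r = r' ∧ (r ≠ 0 → x = x') := by
  have hinj := hX.injOn_map c.1 c.2
  have h1 := hinj (smul_invFunOn_mem_closedBall c (cellFrontier_subset_closedCell _ _ hx) hr)
    (smul_invFunOn_mem_closedBall c (cellFrontier_subset_closedCell _ _ hx') hr') h
  obtain ⟨u, hu, rfl⟩ := hx
  obtain ⟨u', hu', rfl⟩ := hx'
  rw [hinj.leftInvOn_invFunOn (sphere_subset_closedBall hu),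
    hinj.leftInvOn_invFunOn (sphere_subset_closedBall hu')] at h1
  have h2 := congrArg norm h1
  rw [mem_sphere_zero_iff_norm] at hu hu'
  rw [norm_smul, norm_smul, hu, hu', Real.norm_of_nonneg hr.1, Real.norm_of_nonneg hr'.1,
    mul_one, mul_one] at h2
  refine ⟨h2, fun hr0 => ?_⟩
  rw [← h2] at h1
  rw [smul_right_injective _ hr0 h1]

/-- The sum of the first `k + 1` terms of a sequence. -/
def headSum (y : ℕ → ℝ) (k : ℕ) : ℝ := ∑ i ∈ Finset.range (k + 1), y i

theorem headSum_zero (y : ℕ → ℝ) : headSum y 0 = y 0 := by simp [headSum]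

theorem headSum_succ (y : ℕ → ℝ) (k : ℕ) : headSum y (k + 1) = headSum y k + y (k + 1) :=
  Finset.sum_range_succ _ _

theorem headSum_nonneg {y : ℕ → ℝ} (hy : ∀ i, 0 ≤ y i) (k : ℕ) : 0 ≤ headSum y k :=
  Finset.sum_nonneg fun i _ => hy i

theorem headSum_congr_mul {y z : ℕ → ℝ} {k : ℕ} {a : ℝ} (h : ∀ i ≤ k, z i = a * y i) :
    headSum z k = a * headSum y k := by
  rw [headSum, headSum, Finset.mul_sum]
  exact Finset.sum_congr rfl fun i hi => h i (Nat.lt_succ_iff.1 (Finset.mem_range.1 hi))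

theorem headSum_eq_zero {y : ℕ → ℝ} (hy : ∀ i, 0 ≤ y i) {k : ℕ} (h : headSum y k = 0) :
    ∀ i ≤ k, y i = 0 := fun i hi =>
  (Finset.sum_eq_zero_iff_of_nonneg fun i _ => hy i).1 h i
    (Finset.mem_range.2 (Nat.lt_succ_iff.2 hi))

theorem continuous_headSum (k : ℕ) : Continuous fun y : ℕ → ℝ => headSum y k :=
  continuous_finsetSum _ fun i _ => continuous_apply i

theorem headSum_ratio_mem {y : ℕ → ℝ} (hy : ∀ i, 0 ≤ y i) (k : ℕ) :
    headSum y k / headSum y (k + 1) ∈ Icc (0 : ℝ) 1 :=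
  ⟨div_nonneg (headSum_nonneg hy _) (headSum_nonneg hy _),
    div_le_one_of_le₀ (by rw [headSum_succ]; linarith [hy (k + 1)]) (headSum_nonneg hy _)⟩

/-- The point with homogeneous barycentric coordinates `y 0, …, y k` in the simplex spanned by
the centres of the cells `F 0, …, F k`. -/
noncomputable def flagPoint (F : ℕ → Σ n, cell (univ : Set X) n) (y : ℕ → ℝ) : ℕ → X
  | 0 => map (F 0).1 (F 0).2 0
  -- The ratio is the share of mass not at the new centre. If all weights vanish, 0 / 0 = 0 returns
  -- that centre, so the point stays in the cell.
  | k + 1 => cellShrink (F (k + 1)) (headSum y k / headSum y (k + 1)) (flagPoint F y k)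

/-- The first `n + 1` terms of `F` are an increasing sequence of cells of dimensions
`0, …, n`. -/
structure IsFlag (n : ℕ) (F : ℕ → Σ n, cell (univ : Set X) n) : Prop where
  dim : ∀ k ≤ n, (F k).1 = k
  face : ∀ k < n, closedCell (F k).1 (F k).2 ⊆ cellFrontier (F (k + 1)).1 (F (k + 1)).2

theorem IsFlag.flagPoint_mem {n : ℕ} {F : ℕ → Σ n, cell (univ : Set X) n} (hF : IsFlag n F)
    {y : ℕ → ℝ} (hy : ∀ i, 0 ≤ y i) : ∀ k ≤ n, flagPoint F y k ∈ closedCell (F k).1 (F k).2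
  | 0, _ => map_zero_mem_closedCell _ _
  | k + 1, hk => cellShrink_mem_closedCell _
      (cellFrontier_subset_closedCell _ _ (hF.face k hk (hF.flagPoint_mem hy k (by lia))))
      (headSum_ratio_mem hy k)

theorem flagPoint_congr {F G : ℕ → Σ n, cell (univ : Set X) n} {y z : ℕ → ℝ} {a : ℝ}
    (ha : a ≠ 0) : ∀ k, (∀ i ≤ k, F i = G i) → (∀ i ≤ k, z i = a * y i) →
      flagPoint F y k = flagPoint G z k
  | 0, hF, _ => by rw [flagPoint, flagPoint, hF 0 le_rfl]
  | k + 1, hF, hy => by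
    rw [flagPoint, flagPoint, flagPoint_congr ha k (fun i hi => hF i (by lia))
      (fun i hi => hy i (by lia)), hF (k + 1) le_rfl,
      headSum_congr_mul (fun i hi => hy i (by lia)), headSum_congr_mul hy, mul_div_mul_left _ _ ha]

/-- Induction on `k`. Where the earlier weights all vanish, the earlier point may be discontinuous,
but it is multiplied by a ratio tending to zero and its ball coordinate is bounded, so the limit is
the centre. -/
theorem IsFlag.continuousOn_flagPoint [T2Space X] (hX : IsSimpleCWComplex X) {n : ℕ}
    {F : ℕ → Σ n, cell (univ : Set X) n} (hF : IsFlag n F) : ∀ k ≤ n,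
      ContinuousOn (fun y => flagPoint F y k) {y | (∀ i, 0 ≤ y i) ∧ 0 < headSum y k}
  | 0, _ => continuousOn_const
  | k + 1, hk => by
    have ih := hF.continuousOn_flagPoint hX k (by lia)
    set c := F (k + 1)
    have hmem : ∀ y : ℕ → ℝ, (∀ i, 0 ≤ y i) → flagPoint F y k ∈ closedCell c.1 c.2 := fun y hy =>
      cellFrontier_subset_closedCell _ _ (hF.face k hk (hF.flagPoint_mem hy k (by lia)))
    rintro y ⟨hy, hpos⟩
    have hratio : ContinuousAt (fun y => headSum y k / headSum y (k + 1)) y :=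
      (continuous_headSum k).continuousAt.div (continuous_headSum (k + 1)).continuousAt hpos.ne'
    rcases (headSum_nonneg hy k).eq_or_lt with h0 | h0
    · have hlim : Filter.Tendsto (fun y => (headSum y k / headSum y (k + 1)) •
          Function.invFunOn (map c.1 c.2) (closedBall 0 1) (flagPoint F y k))
          (𝓝[{y | (∀ i, 0 ≤ y i) ∧ 0 < headSum y (k + 1)}] y)
          (𝓝[closedBall (0 : Fin c.1 → ℝ) 1] 0) := by
        refine tendsto_nhdsWithin_iff.2 ⟨?_, ?_⟩
        · rw [tendsto_zero_iff_norm_tendsto_zero]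
          have h1 : Filter.Tendsto (fun y => headSum y k / headSum y (k + 1))
              (𝓝[{y | (∀ i, 0 ≤ y i) ∧ 0 < headSum y (k + 1)}] y) (𝓝 0) := by
            have := hratio.tendsto.mono_left (nhdsWithin_le_nhds
              (s := {y | (∀ i, 0 ≤ y i) ∧ 0 < headSum y (k + 1)}))
            rwa [← h0, zero_div] at this
          refine squeeze_zero' (.of_forall fun _ => norm_nonneg _) ?_ h1
          filter_upwards [self_mem_nhdsWithin] with z hz
          have hu : _ ∈ closedBall (0 : Fin c.1 → ℝ) 1 := Function.invFunOn_mem (hmem z hz.1)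
          rw [norm_smul, Real.norm_of_nonneg (headSum_ratio_mem hz.1 k).1]
          exact mul_le_of_le_one_right (headSum_ratio_mem hz.1 k).1 (by simpa using hu)
        · filter_upwards [self_mem_nhdsWithin] with z hz
          exact smul_invFunOn_mem_closedBall c (hmem z hz.1) (headSum_ratio_mem hz.1 k)
      have hm := (continuousOn c.1 c.2) 0 (by simp)
      have hval : flagPoint F y (k + 1) = map c.1 c.2 0 := by
        rw [flagPoint, ← h0, zero_div, cellShrink_zero]
      rw [ContinuousWithinAt, hval]
      exact hm.tendsto.comp hlim
    · have hmaps : ContinuousWithinAt (fun y => flagPoint F y (k + 1))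
          ({y | (∀ i, 0 ≤ y i) ∧ 0 < headSum y (k + 1)} ∩ {y | 0 < headSum y k}) y := by
        refine ContinuousWithinAt.comp (t := closedBall 0 1)
          (g := map c.1 c.2) (f := fun y => (headSum y k / headSum y (k + 1)) •
            Function.invFunOn (map c.1 c.2) (closedBall 0 1) (flagPoint F y k))
          ((continuousOn c.1 c.2) _ ?_) ?_ ?_
        · exact smul_invFunOn_mem_closedBall c (hmem y hy) (headSum_ratio_mem hy k)
        · refine hratio.continuousWithinAt.smul ?_
          exact ContinuousWithinAt.comp (t := closedCell c.1 c.2)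
            (f := fun y => flagPoint F y k) (x := y)
            (hX.continuousOn_invFunOn_map c.1 c.2 _ (hmem y hy))
            ((ih y ⟨hy, h0⟩).mono fun z hz => ⟨hz.1.1, hz.2⟩) fun z hz => hmem z hz.1.1
        · exact fun z hz => smul_invFunOn_mem_closedBall c (hmem z hz.1.1)
            (headSum_ratio_mem hz.1.1 k)
      exact (continuousWithinAt_inter
        ((isOpen_lt continuous_const (continuous_headSum k)).mem_nhds h0)).1 hmaps

/-- Simplices of two flags meet only in faces with common vertices. A nonzero last weight places the
point in the open top cell, which identifies that cell; uniqueness of polar coordinates there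
reduces to the frontier and to induction. -/
theorem IsFlag.flagPoint_eq_iff [T2Space X] (hX : IsSimpleCWComplex X) {n : ℕ}
    {F G : ℕ → Σ n, cell (univ : Set X) n} (hF : IsFlag n F) (hG : IsFlag n G)
    {y z : ℕ → ℝ} (hy : ∀ i, 0 ≤ y i) (hz : ∀ i, 0 ≤ z i) : ∀ k ≤ n,
      headSum y k = headSum z k → 0 < headSum y k →
      (flagPoint F y k = flagPoint G z k ↔ ∀ i ≤ k, y i = z i ∧ (y i ≠ 0 → F i = G i))
  | 0, _ => by
    intro hT hpos
    rw [headSum_zero] at *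
    rw [headSum_zero] at hT
    simp only [flagPoint, Nat.le_zero, forall_eq, hT, true_and]
    refine ⟨fun h _ => ?_, fun h => by rw [h (hT ▸ hpos.ne')]⟩
    by_contra hne
    exact disjoint_left.1 (disjoint_openCell_of_ne hne) (map_zero_mem_openCell _ _)
      (h ▸ map_zero_mem_openCell _ _)
  | k + 1, hk => by
    intro hT hpos
    have ih := hF.flagPoint_eq_iff hX hG hy hz k (by lia)
    have hyF : flagPoint F y k ∈ cellFrontier (F (k + 1)).1 (F (k + 1)).2 :=
      hF.face k hk (hF.flagPoint_mem hy k (by lia))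
    have hzG : flagPoint G z k ∈ cellFrontier (G (k + 1)).1 (G (k + 1)).2 :=
      hG.face k hk (hG.flagPoint_mem hz k (by lia))
    have hyr := headSum_ratio_mem hy k
    have hzr := headSum_ratio_mem hz k
    have hpos' := hT ▸ hpos
    have hsplit : (∀ i ≤ k + 1, y i = z i ∧ (y i ≠ 0 → F i = G i)) ↔
        (∀ i ≤ k, y i = z i ∧ (y i ≠ 0 → F i = G i)) ∧
          (y (k + 1) = z (k + 1) ∧ (y (k + 1) ≠ 0 → F (k + 1) = G (k + 1))) :=
      ⟨fun h => ⟨fun i hi => h i (by lia), h _ le_rfl⟩, fun h i hi => by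
        rcases Nat.le_succ_iff.1 hi with hi | rfl
        exacts [h.1 i hi, h.2]⟩
    have hone : ∀ {w : ℕ → ℝ}, 0 < headSum w (k + 1) →
        (headSum w k / headSum w (k + 1) = 1 ↔ w (k + 1) = 0) := fun {w} hw => by
      rw [div_eq_one_iff_eq hw.ne', headSum_succ]; constructor <;> intro h <;> linarith
    -- The last weights vanish together: otherwise one point is in an open (k+1)-cell and the other
    -- in the `k`-skeleton.
    have hmeet : ∀ {F G : ℕ → Σ n, cell (univ : Set X) n} {y z : ℕ → ℝ}, IsFlag n F → IsFlag n G →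
        (∀ i, 0 ≤ y i) → (∀ i, 0 ≤ z i) → 0 < headSum z (k + 1) →
        headSum y k / headSum y (k + 1) < 1 → z (k + 1) = 0 →
        flagPoint F y (k + 1) ≠ flagPoint G z (k + 1) := by
      intro F G y z hF hG hy hz hzp hlt hz0 heq
      have h1 : flagPoint F y (k + 1) ∈ openCell (F (k + 1)).1 (F (k + 1)).2 :=
        cellShrink_mem_openCell _ (cellFrontier_subset_closedCell _ _
          (hF.face k hk (hF.flagPoint_mem hy k (by lia)))) ⟨(headSum_ratio_mem hy k).1, hlt⟩
      have h2 : flagPoint G z (k + 1) ∈ (skeletonLT (univ : Set X) (k + 1 : ℕ) : Set X) := by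
        rw [flagPoint, (hone hzp).2 hz0, cellShrink_one _ (cellFrontier_subset_closedCell _ _
          (hG.face k hk (hG.flagPoint_mem hz k (by lia))))]
        have := closedCell_subset_skeletonLT _ _ (hG.flagPoint_mem hz k (by lia))
        rwa [hG.dim k (by lia)] at this
      exact disjoint_left.1 (disjoint_skeletonLT_openCell
        (by rw [hF.dim (k + 1) hk])) (heq ▸ h2) h1
    rw [hsplit]
    by_cases hy0 : y (k + 1) = 0
    · by_cases hz0 : z (k + 1) = 0
      · have hT' : headSum y k = headSum z k := by
          rw [headSum_succ, headSum_succ, hy0, hz0] at hT; linarith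
        have hp' : 0 < headSum y k := by
          rw [headSum_succ, hy0] at hpos; linarith
        rw [flagPoint, flagPoint, (hone hpos).2 hy0, (hone hpos').2 hz0,
          cellShrink_one _ (cellFrontier_subset_closedCell _ _ hyF),
          cellShrink_one _ (cellFrontier_subset_closedCell _ _ hzG), ih hT' hp']
        simp [hy0, hz0]
      · have hlt := lt_of_le_of_ne hzr.2 (mt (hone hpos').1 hz0)
        refine ⟨fun h => absurd h.symm (hmeet hG hF hz hy hpos hlt hy0), fun h => ?_⟩
        exact absurd (h.2.1 ▸ hy0) hz0
    · have hlt := lt_of_le_of_ne hyr.2 (mt (hone hpos).1 hy0)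
      by_cases hz0 : z (k + 1) = 0
      · refine ⟨fun h => absurd h (hmeet hF hG hy hz hpos' hlt hz0), fun h => ?_⟩
        exact absurd (h.2.1.trans hz0) hy0
      · have hlt' := lt_of_le_of_ne hzr.2 (mt (hone hpos').1 hz0)
        constructor
        · intro h
          have hc : F (k + 1) = G (k + 1) := by
            by_contra hne
            exact disjoint_left.1 (disjoint_openCell_of_ne hne)
              (cellShrink_mem_openCell _ (cellFrontier_subset_closedCell _ _ hyF) ⟨hyr.1, hlt⟩)
              (h.symm ▸ cellShrink_mem_openCell _ (cellFrontier_subset_closedCell _ _ hzG)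
                ⟨hzr.1, hlt'⟩ : flagPoint F y (k + 1) ∈ _)
          rw [flagPoint, flagPoint, ← hc] at h
          obtain ⟨hr, hx⟩ := cellShrink_eq_cellShrink hX _ hyF (hc ▸ hzG) hyr hzr h
          have hT' : headSum y k = headSum z k := by
            rw [hT] at hr
            exact (div_left_inj' hpos'.ne').1 hr
          have hlast : y (k + 1) = z (k + 1) := by
            rw [headSum_succ, headSum_succ, hT'] at hT; linarith
          refine ⟨?_, hlast, fun _ => hc⟩
          -- At the centre all earlier weights are zero, and nothing is required of the earlier
          -- cells.
          rcases (headSum_nonneg hy k).eq_or_lt with h0 | h0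
          · intro i hi
            rw [headSum_eq_zero hy h0.symm i hi, headSum_eq_zero hz (hT' ▸ h0.symm) i hi]
            simp
          · exact (ih hT' h0).1 (hx (div_pos h0 hpos).ne')
        · rintro ⟨h, hlast, hc⟩
          have hT' : headSum y k = headSum z k := by
            rw [headSum_succ, headSum_succ, hlast] at hT; linarith
          rw [flagPoint, flagPoint, hT, hT', hc hy0]
          rcases (headSum_nonneg hy k).eq_or_lt with h0 | h0
          · rw [← hT', ← h0, zero_div, cellShrink_zero, cellShrink_zero]
          · rw [(ih hT' h0).2 h]

/-- Follow the radius through the point to the frontier, choose a closed cell of codimension one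
there and induct; old weights are scaled by `r` and the new centre receives `1 - r`. -/
theorem exists_flagPoint_eq [T2Space X] (hX : IsSimpleCWComplex X) : ∀ (k : ℕ)
    (e : cell (univ : Set X) k) {x : X}, x ∈ closedCell k e →
      ∃ F, IsFlag k F ∧ F k = ⟨k, e⟩ ∧ ∃ y : ℕ → ℝ, (∀ i, 0 ≤ y i) ∧ headSum y k = 1 ∧
        (∀ i, k < i → y i = 0) ∧ flagPoint F y k = x
  | 0, e, x, hx => by
    rw [closedCell_zero_eq_singleton, mem_singleton_iff] at hx
    refine ⟨fun _ => ⟨0, e⟩, ⟨fun k hk => (Nat.le_zero.1 hk).symm, fun k hk => by lia⟩, rfl,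
      fun i => if i = 0 then 1 else 0, fun i => by positivity, by simp [headSum],
      fun i hi => by simp [hi.ne'], ?_⟩
    rw [flagPoint, hx]
    congr 1
    exact Subsingleton.elim _ _
  | k + 1, e, x, hx => by
    obtain ⟨x', hx', r, hr, rfl⟩ := exists_cellShrink_eq hX e hx
    obtain ⟨f, hxf, hfe⟩ := hX.exists_closedCell_subset_cellFrontier e hx'
    obtain ⟨F, hF, hFk, y, hy, hyk, hy0, rfl⟩ := exists_flagPoint_eq hX k f hxf
    let G : ℕ → Σ n, cell (univ : Set X) n := Function.update F (k + 1) ⟨k + 1, e⟩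
    let z : ℕ → ℝ := Function.update (fun i => r * y i) (k + 1) (1 - r)
    have hGF : ∀ i ≤ k, F i = G i := fun i hi =>
      (Function.update_of_ne (by lia) _ _).symm
    have hzy : ∀ i ≤ k, z i = r * y i := fun i hi => Function.update_of_ne (by lia) _ _
    have hGk : G (k + 1) = ⟨k + 1, e⟩ := Function.update_self _ _ _
    have hzk : z (k + 1) = 1 - r := Function.update_self _ _ _
    have hTk : headSum z k = r := by rw [headSum_congr_mul hzy, hyk, mul_one]
    have hTk' : headSum z (k + 1) = 1 := by rw [headSum_succ, hTk, hzk]; ring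
    refine ⟨G, ⟨fun i hi => ?_, fun i hi => ?_⟩, hGk, z, fun i => ?_, hTk', fun i hi => ?_, ?_⟩
    · rcases Nat.le_succ_iff.1 hi with hi | rfl
      · rw [← hGF i hi, hF.dim i hi]
      · rw [hGk]
    · rcases Nat.lt_succ_iff_lt_or_eq.1 hi with hi | rfl
      · rw [← hGF i hi.le, ← hGF (i + 1) hi]
        exact hF.face i hi
      · rw [← hGF i le_rfl, hGk, hFk]
        exact hfe
    · by_cases h : i = k + 1
      · rw [h, hzk]; linarith [hr.2]
      · simp only [z, Function.update_of_ne h]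
        exact mul_nonneg hr.1 (hy i)
    · simp only [z, Function.update_of_ne hi.ne']
      rw [hy0 i (by lia), mul_zero]
    · rw [flagPoint, hTk, hTk', div_one, hGk]
      by_cases h0 : r = 0
      · rw [h0, cellShrink_zero, cellShrink_zero]
      · rw [← flagPoint_congr h0 k hGF hzy]

end IsSimpleCWComplex

/-! ### A criterion for simple complexes; balls as simplices. -/

/-- A finite family of closed balls in a Hausdorff space whose open balls are disjoint, whose
boundary spheres lie in the balls of smaller dimension, and whose balls of maximal dimension are
dense, defines a simple CW structure. -/
theorem exists_isSimpleCWComplex {X : Type u} [TopologicalSpace X] [T2Space X]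
    (cell : ℕ → Type u) (hfin : ∀ n, Finite (cell n)) (φ : ∀ n, cell n → (Fin n → ℝ) → X)
    (hcont : ∀ n i, ContinuousOn (φ n i) (closedBall 0 1))
    (hinj : ∀ n i, InjOn (φ n i) (closedBall 0 1))
    (hdisj : ∀ n i m j, ∀ x ∈ ball (0 : Fin n → ℝ) 1, ∀ y ∈ ball (0 : Fin m → ℝ) 1,
      φ n i x = φ m j y → (⟨n, i⟩ : Σ n, cell n) = ⟨m, j⟩)
    (hbdry : ∀ n i, ∀ x ∈ sphere (0 : Fin n → ℝ) 1, ∃ m < n, ∃ j,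
      ∃ y ∈ closedBall (0 : Fin m → ℝ) 1, φ m j y = φ n i x)
    (hcover : ∀ x, ∃ n i, ∃ y ∈ closedBall (0 : Fin n → ℝ) 1, φ n i y = x)
    (hpure : ∃ n, (∀ m, n < m → IsEmpty (cell m)) ∧ closure (⋃ i, φ n i '' ball 0 1) = univ) :
    ∃ _ : CWComplex (univ : Set X), IsSimpleCWComplex X ∧
      ∀ n (e : RelCWComplex.cell (univ : Set X) n), ∃ i : cell n,
        RelCWComplex.openCell n e = φ n i '' ball 0 1 := by
  obtain ⟨N, hN, hdense⟩ := hpure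
  let map : ∀ n, cell n → PartialEquiv (Fin n → ℝ) X := fun n i =>
    ((hinj n i).mono ball_subset_closedBall).toPartialEquiv
  have hempty : ∀ᶠ n in Filter.atTop, IsEmpty (cell n) :=
    Filter.eventually_atTop.2 ⟨N + 1, fun m hm => hN m hm⟩
  have hsymm : ∀ n i, ContinuousOn (map n i).symm (map n i).target := by
    intro n i
    refine ((hcont n i).continuousOn_invFunOn_image (isCompact_closedBall _ _)
      (hinj n i)).congr_mono ?_ (image_mono ball_subset_closedBall)
    rintro _ ⟨x, hx, rfl⟩
    rw [(hinj n i).leftInvOn_invFunOn (ball_subset_closedBall hx)]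
    exact (map n i).left_inv hx
  have hpd : (univ : Set (Σ n, cell n)).PairwiseDisjoint
      (fun ni => map ni.1 ni.2 '' ball 0 1) := by
    rintro ⟨n, i⟩ - ⟨m, j⟩ - hne
    refine disjoint_left.2 ?_
    rintro _ ⟨x, hx, rfl⟩ ⟨y, hy, hxy⟩
    exact hne (hdisj n i m j x hx y hy hxy.symm)
  have hmaps : ∀ n i, MapsTo (map n i) (sphere 0 1)
      (⋃ (m < n) (j : cell m), map m j '' closedBall 0 1) := by
    intro n i x hx
    obtain ⟨m, hm, j, y, hy, hyx⟩ := hbdry n i x hx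
    exact mem_iUnion₂.2 ⟨m, hm, mem_iUnion.2 ⟨j, y, hy, hyx⟩⟩
  have hunion : ⋃ (n : ℕ) (j : cell n), map n j '' closedBall 0 1 = univ := by
    refine eq_univ_of_forall fun x => ?_
    obtain ⟨n, i, y, hy, hyx⟩ := hcover x
    exact mem_iUnion₂.2 ⟨n, i, y, hy, hyx⟩
  let S := CWComplex.mkFinite (univ : Set X) cell map hempty hfin (fun _ _ => rfl) hcont hsymm hpd
    hmaps hunion
  refine ⟨S, ⟨CWComplex.finite_mkFinite (univ : Set X) cell map hempty hfin (fun _ _ => rfl) hcont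
    hsymm hpd hmaps hunion, ⟨N, hN, hdense⟩, fun n e => ?_⟩, fun n e => ⟨e, rfl⟩⟩
  have hc : Continuous fun x : closedBall (0 : Fin n → ℝ) 1 => φ n e x :=
    (hcont n e).domRestrict
  exact (hc.isClosedEmbedding fun x y h =>
    Subtype.ext (hinj n e x.2 y.2 h)).isEmbedding

/-- The closed unit ball of any norm on a space of dimension `m` is homeomorphic to the
`m`-simplex, and the homeomorphism respects interiors. -/
theorem exists_homeomorph_closedBall_stdSimplex (E : Type*) [NormedAddCommGroup E]
    [NormedSpace ℝ E] [FiniteDimensional ℝ E] {m : ℕ} (hm : Module.finrank ℝ E = m) :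
    ∃ Θ : closedBall (0 : E) 1 ≃ₜ stdSimplex ℝ (Fin (m + 1)),
      ∀ x, (∀ i, 0 < (Θ x).1 i) ↔ ‖x.1‖ < 1 := by
  obtain ⟨b⟩ := AffineBasis.exists_affineBasis_of_finiteDimensional (ι := Fin (m + 1)) (k := ℝ)
    (P := E) (by simp [hm])
  set s := convexHull ℝ (range b) with hs
  -- The hull of an affine basis is a convex body, so an ambient homeomorphism takes it to the ball,
  -- interior to interior; barycentric coordinates do the rest.
  obtain ⟨h, hint, hcl, -⟩ := exists_homeomorph_image_interior_closure_frontier_eq_unitBall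
    (convex_convexHull ℝ (range b)) ⟨_, b.centroid_mem_interior_convexHull⟩
    (isBounded_convexHull.2 (finite_range b).isBounded)
  rw [((finite_range b).isCompact_convexHull ℝ).isClosed.closure_eq] at hcl
  have hmem : ∀ x, x ∈ closedBall (0 : E) 1 ↔ ∀ i, 0 ≤ b.coord i (h.symm x) := fun x => by
    rw [← hcl, h.image_eq_preimage_symm, mem_preimage, b.convexHull_eq_nonneg_coord]; rfl
  have hmem' : ∀ x, ‖x‖ < 1 ↔ ∀ i, 0 < b.coord i (h.symm x) := fun x => by
    rw [← mem_ball_zero_iff, ← hint, h.image_eq_preimage_symm, mem_preimage,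
      b.interior_convexHull]; rfl
  let f : closedBall (0 : E) 1 → stdSimplex ℝ (Fin (m + 1)) := fun x =>
    ⟨fun i => b.coord i (h.symm x), (hmem x).1 x.2, b.sum_coord_apply_eq_one _⟩
  have hf : Continuous f := Continuous.subtype_mk (continuous_pi fun i =>
    (continuous_barycentric_coord b i).comp (h.symm.continuous.comp continuous_subtype_val)) _
  have hbij : Function.Bijective f := by
    constructor
    · intro x y hxy
      refine Subtype.ext (h.symm.injective (b.ext_elem fun i => ?_))
      exact congrFun (congrArg Subtype.val hxy) i
    · intro w
      let p := Finset.univ.affineCombination ℝ b w.1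
      have hp : ∀ i, b.coord i p = w.1 i := fun i =>
        b.coord_apply_combination_of_mem (Finset.mem_univ i) w.2.2
      refine ⟨⟨h p, (hmem _).2 fun i => ?_⟩, Subtype.ext (funext fun i => ?_)⟩
      · rw [h.symm_apply_apply, hp]; exact w.2.1 i
      · simp only [f, h.symm_apply_apply, hp]
  exact ⟨hf.homeoOfEquivCompactToT2 (f := Equiv.ofBijective f hbij), fun x => (hmem' x).symm⟩

/-! ### The standard simplex as a simple complex. -/

section StdSimplex

variable {n : ℕ}

/-- The inclusion of the face of the standard simplex spanned by a set of vertices. -/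
noncomputable def simplexFace {m : ℕ} (S : Finset (Fin (n + 1))) (hS : S.card = m + 1)
    (w : stdSimplex ℝ (Fin (m + 1))) : stdSimplex ℝ (Fin (n + 1)) :=
  ⟨Function.extend (S.orderEmbOfFin hS) w.1 0, by
    refine ⟨fun i => ?_, ?_⟩
    · by_cases h : ∃ j, S.orderEmbOfFin hS j = i
      · obtain ⟨j, rfl⟩ := h
        rw [(S.orderEmbOfFin hS).injective.extend_apply]
        exact w.2.1 j
      · rw [Function.extend_apply' _ _ _ h]; exact le_rfl
    · rw [← w.2.2]
      refine (Fintype.sum_of_injective _ (S.orderEmbOfFin hS).injective _ _ ?_ ?_).symm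
      · intro i hi
        exact Function.extend_apply' _ _ _ hi
      · intro j
        rw [(S.orderEmbOfFin hS).injective.extend_apply]⟩

theorem simplexFace_apply {m : ℕ} (S : Finset (Fin (n + 1))) (hS : S.card = m + 1)
    (w : stdSimplex ℝ (Fin (m + 1))) (j : Fin (m + 1)) :
    (simplexFace S hS w).1 (S.orderEmbOfFin hS j) = w.1 j :=
  (S.orderEmbOfFin hS).injective.extend_apply _ _ _

theorem simplexFace_apply_of_notMem {m : ℕ} (S : Finset (Fin (n + 1))) (hS : S.card = m + 1)
    (w : stdSimplex ℝ (Fin (m + 1))) {i : Fin (n + 1)} (hi : i ∉ S) :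
    (simplexFace S hS w).1 i = 0 :=
  Function.extend_apply' _ _ _ fun ⟨j, hj⟩ => hi (hj ▸ S.orderEmbOfFin_mem hS j)

theorem continuous_simplexFace {m : ℕ} (S : Finset (Fin (n + 1))) (hS : S.card = m + 1) :
    Continuous (simplexFace S hS) := by
  refine Continuous.subtype_mk (continuous_pi fun i => ?_) _
  by_cases h : ∃ j, S.orderEmbOfFin hS j = i
  · obtain ⟨j, rfl⟩ := h
    simp_rw [(S.orderEmbOfFin hS).injective.extend_apply]
    exact (continuous_apply j).comp continuous_subtype_val
  · simp_rw [Function.extend_apply' _ _ _ h]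
    exact continuous_const

theorem simplexFace_injective {m : ℕ} (S : Finset (Fin (n + 1))) (hS : S.card = m + 1) :
    Function.Injective (simplexFace S hS) := fun w w' h =>
  Subtype.ext (funext fun j => by
    rw [← simplexFace_apply S hS, ← simplexFace_apply S hS w', h])

theorem exists_simplexFace_eq {m : ℕ} (S : Finset (Fin (n + 1))) (hS : S.card = m + 1)
    (z : stdSimplex ℝ (Fin (n + 1))) (hz : ∀ i ∉ S, z.1 i = 0) :
    ∃ w, simplexFace S hS w = z := by
  have hrange : ∀ i, i ∉ range (S.orderEmbOfFin hS) → z.1 i = 0 := fun i hi =>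
    hz i fun hiS => hi (by rw [Finset.range_orderEmbOfFin]; exact hiS)
  refine ⟨⟨fun j => z.1 (S.orderEmbOfFin hS j), fun j => z.2.1 _, ?_⟩,
    Subtype.ext (funext fun i => ?_)⟩
  · rw [← z.2.2]
    exact Fintype.sum_of_injective _ (S.orderEmbOfFin hS).injective _ _ hrange fun _ => rfl
  · by_cases hi : i ∈ range (S.orderEmbOfFin hS)
    · obtain ⟨j, rfl⟩ := hi
      rw [simplexFace_apply]
    · rw [hrange i hi]
      exact Function.extend_apply' _ _ _ hi

/-- A space homeomorphic to the standard simplex has a simple CW structure whose open cells are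
the open faces. -/
theorem exists_isSimpleCWComplex_of_homeomorph_stdSimplex {Y : Type} [TopologicalSpace Y]
    [T2Space Y] (Ψ : Y ≃ₜ stdSimplex ℝ (Fin (n + 1))) :
    ∃ _ : CWComplex (univ : Set Y), IsSimpleCWComplex Y ∧
      ∀ m (e : RelCWComplex.cell (univ : Set Y) m), ∀ y ∈ RelCWComplex.openCell m e,
        ∀ y' ∈ RelCWComplex.openCell m e, ∀ i, (Ψ y).1 i = 0 ↔ (Ψ y').1 i = 0 := by
  classical
  have hfr : ∀ m, Module.finrank ℝ (Fin m → ℝ) = m := fun m => by simp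
  choose Θ hΘ using fun m => exists_homeomorph_closedBall_stdSimplex (Fin m → ℝ) (hfr m)
  -- A cell is a nonempty set of vertices; the open cell of a point is given by its support.
  let cell : ℕ → Type := fun m => {S : Finset (Fin (n + 1)) // S.card = m + 1}
  let φ : ∀ m, cell m → (Fin m → ℝ) → Y := fun m S x =>
    if h : x ∈ closedBall 0 1 then Ψ.symm (simplexFace S.1 S.2 (Θ m ⟨x, h⟩))
    else Ψ.symm ⟨_, single_mem_stdSimplex ℝ 0⟩
  have hφ : ∀ m S x (h : x ∈ closedBall 0 1),
      φ m S x = Ψ.symm (simplexFace S.1 S.2 (Θ m ⟨x, h⟩)) := fun m S x h => dif_pos h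
  have hcont : ∀ m S, ContinuousOn (φ m S) (closedBall 0 1) := by
    intro m S
    rw [continuousOn_iff_continuous_domRestrict]
    have : (closedBall 0 1).domRestrict (φ m S) =
        fun x => Ψ.symm (simplexFace S.1 S.2 (Θ m x)) := funext fun x => hφ m S x.1 x.2
    rw [this]
    exact Ψ.symm.continuous.comp ((continuous_simplexFace _ _).comp (Θ m).continuous)
  have hsupp : ∀ m (S : cell m), ∀ x ∈ ball (0 : Fin m → ℝ) 1, ∀ i,
      (Ψ (φ m S x)).1 i = 0 ↔ i ∉ S.1 := by
    intro m S x hx i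
    rw [hφ m S x (ball_subset_closedBall hx), Ψ.apply_symm_apply]
    refine ⟨fun h hi => ?_, simplexFace_apply_of_notMem _ _ _⟩
    have hi : i ∈ range (S.1.orderEmbOfFin S.2) := by
      rw [Finset.range_orderEmbOfFin]; exact hi
    obtain ⟨j, rfl⟩ := hi
    rw [simplexFace_apply] at h
    exact ((hΘ m ⟨x, _⟩).2 (by simpa using hx) j).ne' h
  have hface : ∀ m (S : cell m) (y : Y), (∀ i ∉ S.1, (Ψ y).1 i = 0) →
      ∃ x ∈ closedBall (0 : Fin m → ℝ) 1, φ m S x = y := by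
    intro m S y hy
    obtain ⟨w, hw⟩ := exists_simplexFace_eq S.1 S.2 (Ψ y) hy
    obtain ⟨x, rfl⟩ := (Θ m).surjective w
    exact ⟨x, x.2, by rw [hφ m S x x.2, hw, Ψ.symm_apply_apply]⟩
  have hex : ∀ y, ∃ m, ∃ S : cell m, (∀ i, i ∈ S.1 ↔ (Ψ y).1 i ≠ 0) := by
    intro y
    let S := Finset.univ.filter fun i => (Ψ y).1 i ≠ 0
    have hne : S.card ≠ 0 := by
      intro h
      have h0 : ∀ i, (Ψ y).1 i = 0 := fun i => by
        by_contra hi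
        exact Finset.notMem_empty i (Finset.card_eq_zero.1 h ▸ (by simpa [S] using hi))
      have := (Ψ y).2.2
      simp [h0] at this
    obtain ⟨m, hm⟩ := Nat.exists_eq_succ_of_ne_zero hne
    exact ⟨m, ⟨S, hm⟩, fun i => by simp [S]⟩
  obtain ⟨S, hS, hopen⟩ := exists_isSimpleCWComplex cell
    (fun m => inferInstanceAs (Finite {S : Finset (Fin (n + 1)) // S.card = m + 1})) φ hcont
    (by
      intro m S x hx y hy h
      rw [hφ m S x hx, hφ m S y hy] at h
      exact congrArg Subtype.val
        ((Θ m).injective (simplexFace_injective _ _ (Ψ.symm.injective h))))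
    (by
      intro m S m' S' x hx x' hx' h
      have hSS : S.1 = S'.1 := by
        ext i
        have h1 := hsupp m S x hx i
        rw [h, hsupp m' S' x' hx' i, not_iff_not] at h1
        exact h1.symm
      obtain rfl : m = m' := by
        have h1 := S.2
        have h2 := S'.2
        rw [hSS] at h1
        lia
      rw [Subtype.ext hSS])
    (by
      intro m S x hx
      obtain ⟨m', S', hS'⟩ := hex (φ m S x)
      have hxc := sphere_subset_closedBall hx
      have hsub : S'.1 ⊆ S.1 := by
        intro i hi
        by_contra hiS
        refine (hS' i).1 hi ?_
        rw [hφ m S x hxc, Ψ.apply_symm_apply]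
        exact simplexFace_apply_of_notMem _ _ _ hiS
      -- Full support on the face would put `x` in the open ball, so a boundary point has smaller
      -- support.
      have hne : S'.1 ≠ S.1 := by
        intro heq
        have : ‖x‖ < 1 := (hΘ m ⟨x, hxc⟩).1 fun j => by
          refine lt_of_le_of_ne ((Θ m ⟨x, hxc⟩).2.1 j) (Ne.symm ?_)
          rw [← simplexFace_apply S.1 S.2, ← Ψ.apply_symm_apply (simplexFace _ _ _), ← hφ m S x hxc]
          exact (hS' _).1 (heq.symm.subset (S.1.orderEmbOfFin_mem S.2 j))
        rw [mem_sphere_zero_iff_norm.1 hx] at this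
        exact lt_irrefl _ this
      have hcard := Finset.card_lt_card (hsub.ssubset_of_ne hne)
      rw [S.2, S'.2] at hcard
      obtain ⟨y, hy, hyx⟩ := hface m' S' (φ m S x) fun i hi => by
        by_contra h0; exact hi ((hS' i).2 h0)
      exact ⟨m', by lia, S', y, hy, hyx⟩)
    (by
      intro y
      obtain ⟨m, S, hS⟩ := hex y
      exact ⟨m, S, hface m S y fun i hi => by by_contra h0; exact hi ((hS i).2 h0)⟩)
    (by
      refine ⟨n, fun m hm => ⟨fun S => ?_⟩, ?_⟩
      · have h1 := S.2
        have h2 := Finset.card_le_univ S.1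
        rw [Fintype.card_fin] at h2
        lia
      · let T : cell n := ⟨Finset.univ, by simp⟩
        refine eq_univ_of_univ_subset ?_
        calc univ ⊆ φ n T '' closedBall 0 1 := fun y _ =>
              hface n T y fun i hi => absurd (Finset.mem_univ i) hi
          _ = φ n T '' closure (ball 0 1) := by rw [closure_ball _ one_ne_zero]
          _ ⊆ closure (φ n T '' ball 0 1) :=
              ContinuousOn.image_closure (by rw [closure_ball _ one_ne_zero]; exact hcont n T)
          _ ⊆ _ := closure_mono (subset_iUnion (fun i => φ n i '' ball 0 1) T))
  refine ⟨S, hS, fun m e y hy y' hy' i => ?_⟩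
  obtain ⟨S, hSe⟩ := hopen m e
  rw [hSe] at hy hy'
  obtain ⟨x, hx, rfl⟩ := hy
  obtain ⟨x', hx', rfl⟩ := hy'
  rw [hsupp m S x hx, hsupp m S x' hx']

end StdSimplex

/-! ### From simplices to a finite branched covering. -/

theorem encard_range_eq_of_eq_iff {ι α β : Type*} {a : ι → α} {b : ι → β}
    (h : ∀ i j, a i = a j ↔ b i = b j) : (range a).encard = (range b).encard := by
  have hker : Setoid.ker a = Setoid.ker b := Setoid.ext fun i j => h i j
  have e := Setoid.quotientKerEquivRange a
  rw [hker] at e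
  exact encard_congr (e.symm.trans (Setoid.quotientKerEquivRange b))

/-- A jointly surjective finite family of sections with pairwise compatible projections defines
a branched covering. -/
theorem exists_branchedCovering_of_sections {X Y ι : Type*} [TopologicalSpace X]
    [TopologicalSpace Y] [CompactSpace Y] [T2Space X] [Finite ι] {σ : ι → Y → X}
    (hσ : ∀ i, Continuous (σ i)) (hinj : ∀ i j y z, σ i y = σ j z → y = z)
    (hsurj : ∀ x, ∃ i y, σ i y = x) :
    ∃ h : BranchedCovering (Nat.card ι) X Y, ∀ i y, h.proj (σ i y) = y := by
  choose i p hp using hsurj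
  have hpσ : ∀ j y, p (σ j y) = y := fun j y => hinj _ _ _ _ (hp (σ j y))
  -- The preimage of a closed set is a finite union of compact images under the sections.
  have hpc : Continuous p := by
    refine continuous_iff_isClosed.2 fun C hC => ?_
    have : p ⁻¹' C = ⋃ j, σ j '' C := by
      ext x
      simp only [mem_preimage, mem_iUnion]
      refine ⟨fun hx => ⟨i x, p x, hx, hp x⟩, ?_⟩
      rintro ⟨j, y, hy, rfl⟩
      rwa [hpσ]
    rw [this]
    exact isClosed_iUnion_of_finite fun j => (hC.isCompact.image (hσ j)).isClosed
  let e : Fin (Nat.card ι) ≃ ι := (Finite.equivFin ι).symm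
  -- Every section counts, coincidences giving multiplicity; continuity comes from factoring through
  -- the power of `X`.
  let t : Y → Sym X (Nat.card ι) := fun y =>
    Sym.mk (Multiset.map (fun k => σ (e k) y) Finset.univ.val) (by simp)
  have htc : Continuous t :=
    Continuous.comp (continuous_coinduced_rng (f := fun v : Fin (Nat.card ι) → X =>
      (Sym.mk (Multiset.map v Finset.univ.val) (by simp) : Sym X (Nat.card ι))))
      (continuous_pi fun k => hσ (e k))
  have hmem : ∀ x y, x ∈ t y ↔ ∃ j, σ j y = x := by
    intro x y
    rw [Sym.mem_mk, Multiset.mem_map]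
    exact ⟨fun ⟨k, _, hk⟩ => ⟨e k, hk⟩, fun ⟨j, hj⟩ => ⟨e.symm j, Finset.mem_univ_val _, by simpa⟩⟩
  refine ⟨⟨⟨p, hpc⟩, ⟨t, htc⟩, fun x => (hmem _ _).2 ⟨i x, hp x⟩, fun y => ?_⟩, hpσ⟩
  rw [Sym.eq_replicate_iff]
  intro b hb
  obtain ⟨x, hx, rfl⟩ := Sym.mem_map.1 hb
  obtain ⟨j, rfl⟩ := (hmem _ _).1 hx
  exact hpσ j y

namespace IsSimpleCWComplex

open CWComplex

/-- Extension of a finite sequence by zero. -/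
def extendZero {n : ℕ} (y : Fin (n + 1) → ℝ) (i : ℕ) : ℝ :=
  if h : i < n + 1 then y ⟨i, h⟩ else 0

variable {n : ℕ}

theorem extendZero_val (y : Fin (n + 1) → ℝ) (i : Fin (n + 1)) : extendZero y i = y i :=
  dif_pos i.2

theorem extendZero_nonneg {y : Fin (n + 1) → ℝ} (hy : ∀ i, 0 ≤ y i) (i : ℕ) :
    0 ≤ extendZero y i := by
  unfold extendZero
  split_ifs
  exacts [hy _, le_rfl]

theorem continuous_extendZero :
    Continuous (extendZero : (Fin (n + 1) → ℝ) → ℕ → ℝ) := by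
  refine continuous_pi fun i => ?_
  by_cases h : i < n + 1
  · simpa [extendZero, h] using continuous_apply _
  · simpa [extendZero, h] using continuous_const

theorem headSum_extendZero (y : Fin (n + 1) → ℝ) : headSum (extendZero y) n = ∑ i, y i := by
  rw [headSum, Finset.sum_range]
  exact Finset.sum_congr rfl fun i _ => extendZero_val y i

variable {X : Type u} [TopologicalSpace X] [T2Space X] [CWComplex (univ : Set X)]

theorem exists_mem_closedCell {n : ℕ} (hX : IsSimpleCWComplex X)
    (hn : closure (⋃ e : cell (univ : Set X) n, openCell n e) = univ) (x : X) :
    ∃ e : cell (univ : Set X) n, x ∈ closedCell n e := by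
  have := hX.finite_cell n
  have h : closure (⋃ e : cell (univ : Set X) n, openCell n e) ⊆ ⋃ e, closedCell n e :=
    closure_minimal (iUnion_mono fun e => openCell_subset_closedCell n e)
      (isClosed_iUnion_of_finite fun _ => isClosed_closedCell)
  rw [hn] at h
  exact mem_iUnion.1 (h (mem_univ x))

/-- The barycentric subdivision of a pure simple CW complex: it is the union of finitely many
simplices, glued along faces with the same vertices. -/
theorem exists_simplices (hX : IsSimpleCWComplex X)
    (hn : closure (⋃ e : cell (univ : Set X) n, openCell n e) = univ) :
    ∃ (ι : Type u) (_ : Finite ι) (v : ι → Fin (n + 1) → Σ m, cell (univ : Set X) m)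
      (σ : ι → stdSimplex ℝ (Fin (n + 1)) → X),
      (∀ i, Continuous (σ i)) ∧ (∀ x, ∃ i y, σ i y = x) ∧
      ∀ i j y z, σ i y = σ j z ↔ y = z ∧ ∀ k, y.1 k ≠ 0 → v i k = v j k := by
  have := hX.finite_sigma_cell
  -- Flags as finite sequences, hence finitely many. Indices beyond `n` wrap around modulo n + 1,
  -- where `IsFlag` imposes nothing.
  let ι := {f : Fin (n + 1) → Σ m, cell (univ : Set X) m //
    IsFlag n fun k => f (Fin.ofNat (n + 1) k)}
  have hofNat : ∀ k : Fin (n + 1), Fin.ofNat (n + 1) (k : ℕ) = k := fun k =>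
    Fin.ext (Nat.mod_eq_of_lt k.2)
  have hpos : ∀ y : stdSimplex ℝ (Fin (n + 1)), headSum (extendZero y.1) n = 1 := fun y => by
    rw [headSum_extendZero, y.2.2]
  refine ⟨ι, inferInstance, fun f => f.1,
    fun f y => flagPoint (fun k => f.1 (Fin.ofNat (n + 1) k)) (extendZero y.1) n, ?_, ?_, ?_⟩
  · intro f
    refine (f.2.continuousOn_flagPoint hX n le_rfl).comp_continuous
      (continuous_extendZero.comp continuous_subtype_val) fun y => ⟨extendZero_nonneg y.2.1, ?_⟩
    exact (hpos y).ge.trans_lt' one_pos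
  · intro x
    obtain ⟨e, he⟩ := hX.exists_mem_closedCell hn x
    obtain ⟨F, hF, -, y, hy, hy1, hy0, rfl⟩ := exists_flagPoint_eq hX n e he
    have hFk : ∀ k ≤ n, F k = F (Fin.ofNat (n + 1) k) := fun k hk => by
      congr 1; exact (Nat.mod_eq_of_lt (Nat.lt_succ_iff.2 hk)).symm
    have hflag : IsFlag n fun k => F (Fin.ofNat (n + 1) k) := by
      refine ⟨fun k hk => ?_, fun k hk => ?_⟩
      · rw [← hFk k hk, hF.dim k hk]
      · rw [← hFk k hk.le, ← hFk (k + 1) hk]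
        exact hF.face k hk
    refine ⟨⟨fun k => F k, hflag⟩, ⟨fun k => y k, fun k => hy k, ?_⟩, ?_⟩
    · rw [← hy1, headSum, Finset.sum_range]
    · refine (flagPoint_congr one_ne_zero n hFk fun i hi => ?_).symm
      rw [one_mul]
      exact dif_pos (Nat.lt_succ_iff.2 hi)
  · intro f g y z
    rw [f.2.flagPoint_eq_iff hX g.2 (extendZero_nonneg y.2.1) (extendZero_nonneg z.2.1) n le_rfl
      (by rw [hpos, hpos]) (by rw [hpos]; exact one_pos)]
    constructor
    · intro h
      have h' : ∀ k : Fin (n + 1), y.1 k = z.1 k ∧ (y.1 k ≠ 0 → f.1 k = g.1 k) := fun k => by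
        simpa only [extendZero_val, hofNat] using h k (Nat.lt_succ_iff.1 k.2)
      exact ⟨Subtype.ext (funext fun k => (h' k).1), fun k => (h' k).2⟩
    · rintro ⟨rfl, h⟩ k hk
      refine ⟨rfl, fun hy => h _ ?_⟩
      have : extendZero y.1 k = y.1 (Fin.ofNat (n + 1) k) := by
        rw [← extendZero_val y.1 (Fin.ofNat (n + 1) k)]
        congr 1; exact (Nat.mod_eq_of_lt (Nat.lt_succ_iff.2 hk)).symm
      rwa [← this]

/-- The fibre over a point is the set of values of the sections there, so its size depends only on
which sections coincide, and thus only on which barycentric coordinates vanish. -/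
theorem exists_branchedCovering_isFinite (hX : IsSimpleCWComplex X) :
    ∃ (n d : ℕ) (h : BranchedCovering d X (closedBall (0 : EuclideanSpace ℝ (Fin n)) 1)),
      h.IsFinite := by
  obtain ⟨n, -, hn⟩ := hX.pure
  obtain ⟨ι, hι, v, σ, hσ, hsurj, heq⟩ := hX.exists_simplices hn
  obtain ⟨Ψ, -⟩ := exists_homeomorph_closedBall_stdSimplex (EuclideanSpace ℝ (Fin n)) (m := n)
    (by simp)
  obtain ⟨h, hh⟩ := exists_branchedCovering_of_sections (σ := fun i y => σ i (Ψ y))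
    (fun i => (hσ i).comp Ψ.continuous)
    (fun i j y z hyz => Ψ.injective ((heq i j _ _).1 hyz).1)
    (fun x => by
      obtain ⟨i, y, hy⟩ := hsurj x
      exact ⟨i, Ψ.symm y, by rwa [Ψ.apply_symm_apply]⟩)
  obtain ⟨S, hS, hcell⟩ := exists_isSimpleCWComplex_of_homeomorph_stdSimplex Ψ
  refine ⟨n, Nat.card ι, h, S, hS, fun m e y hy y' hy' => ?_⟩
  have hfib : ∀ y, h.proj ⁻¹' {y} = range fun i => σ i (Ψ y) := by
    intro y
    ext x
    constructor
    · rintro rfl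
      obtain ⟨i, z, rfl⟩ := hsurj x
      have := hh i (Ψ.symm z)
      rw [Ψ.apply_symm_apply] at this
      exact ⟨i, by simp only [this, Ψ.apply_symm_apply]⟩
    · rintro ⟨i, rfl⟩
      exact hh i y
  rw [hfib, hfib]
  refine encard_range_eq_of_eq_iff fun i j => ?_
  rw [heq, heq]
  simp only [true_and, ne_eq, hcell m e y hy y' hy']

end IsSimpleCWComplex

/-! ### Coverings from constant fibre size, and limits of lifts. -/

/-- An open map from a Hausdorff space whose fibres are finite and have the same number of points
is a covering map. -/
theorem IsOpenMap.isCoveringMap_of_encard_eq {P B : Type*} [TopologicalSpace P]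
    [TopologicalSpace B] [T2Space P] {p : P → B} (hc : Continuous p) (ho : IsOpenMap p)
    (hfin : ∀ b, (p ⁻¹' {b}).Finite)
    (hcard : ∀ b b', (p ⁻¹' {b}).encard = (p ⁻¹' {b'}).encard) : IsCoveringMap p := by
  intro b
  have hF := hfin b
  have : Finite (p ⁻¹' {b}) := hF
  obtain ⟨U, hU, hdisj⟩ := hF.t2_separation
  -- Over `N` each of the disjoint sets `U x` contains a point of the fibre; equality of cardinals
  -- forces exactly one in each and none elsewhere.
  let N : Set B := ⋂ x ∈ p ⁻¹' {b}, p '' U x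
  have hN : IsOpen N := hF.isOpen_biInter fun x _ => ho _ (hU x).2
  have hbN : b ∈ N := mem_iInter₂.2 fun x hx => ⟨x, (hU x).1, hx⟩
  have hidx : ∀ z : p ⁻¹' N, ∃ x : p ⁻¹' {b}, z.1 ∈ U x := by
    intro z
    choose g hg using fun x : p ⁻¹' {b} => mem_iInter₂.1 z.2 x.1 x.2
    have hgi : Function.Injective g := fun x y hxy => by
      by_contra hne
      exact disjoint_left.1 (hdisj x.2 y.2 fun h => hne (Subtype.ext h)) (hg x).1
        (hxy ▸ (hg y).1)
    have hsub : range g ⊆ p ⁻¹' {p z} := by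
      rintro _ ⟨x, rfl⟩
      exact (hg x).2
    have heq : range g = p ⁻¹' {p z} := by
      refine (hfin (p z)).eq_of_subset_of_encard_le' hsub ?_
      rw [hcard (p z) b, ← image_univ, hgi.encard_image, encard_univ]
      exact le_rfl
    obtain ⟨x, hx⟩ : z.1 ∈ range g := heq ▸ rfl
    exact ⟨x, hx ▸ (hg x).1⟩
  choose idx hidx using hidx
  have huniq : ∀ (z : p ⁻¹' N) (x : p ⁻¹' {b}), z.1 ∈ U x → idx z = x := fun z x hx => by
    by_contra hne
    exact disjoint_left.1 (hdisj (idx z).2 x.2 fun h => hne (Subtype.ext h)) (hidx z) hx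
  have hinj : ∀ z z' : p ⁻¹' N, p z = p z' → idx z = idx z' → z = z' := by
    intro z z' hp hi
    by_contra hne
    have hne' : z.1 ≠ z'.1 := fun h => hne (Subtype.ext h)
    choose g hg using fun x : p ⁻¹' {b} => mem_iInter₂.1 z.2 x.1 x.2
    classical
    let g' : p ⁻¹' {b} → P := fun x => if x = idx z then z.1 else g x
    let f : Option (p ⁻¹' {b}) → P := fun o => o.elim z'.1 g'
    have hg'U : ∀ x : p ⁻¹' {b}, g' x ∈ U x := fun x => by
      by_cases h : x = idx z
      · simp only [g', h, if_true]; exact hidx z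
      · simp only [g', h, if_false]; exact (hg x).1
    have hg'p : ∀ x : p ⁻¹' {b}, p (g' x) = p z := fun x => by
      by_cases h : x = idx z
      · simp only [g', h, if_true]
      · simp only [g', h, if_false]; exact (hg x).2
    have hg'i : Function.Injective g' := fun x y hxy => by
      by_contra hne
      exact disjoint_left.1 (hdisj x.2 y.2 fun h => hne (Subtype.ext h)) (hg'U x)
        (hxy ▸ hg'U y)
    have hg'z : z'.1 ∉ range g' := by
      rintro ⟨x, hx⟩
      have hx' : idx z' = x := huniq z' x (hx ▸ hg'U x)
      simp only [g', ← hx', ← hi, if_true] at hx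
      exact hne' hx
    have hsub : insert z'.1 (range g') ⊆ p ⁻¹' {p z} := by
      rintro _ (rfl | ⟨x, rfl⟩)
      exacts [hp.symm, hg'p x]
    have h1 := encard_le_encard hsub
    rw [encard_insert_of_notMem hg'z, hcard (p z) b, ← image_univ, hg'i.encard_image,
      encard_univ] at h1
    exact absurd h1 (not_le.2 (ENat.lt_add_one_iff hF.encard_lt_top.ne |>.2 le_rfl))
  let K : p ⁻¹' N → N × (p ⁻¹' {b}) := fun z => (⟨p z, z.2⟩, idx z)
  have hKc : Continuous K := by
    refine Continuous.prodMk (Continuous.subtype_mk (hc.comp continuous_subtype_val) _) ?_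
    refine continuous_discrete_rng.2 fun x => ?_
    have : idx ⁻¹' {x} = Subtype.val ⁻¹' U x := by
      ext z
      exact ⟨fun h => by rw [← (h : idx z = x)]; exact hidx z, huniq z x⟩
    rw [this]
    exact (hU x).2.preimage continuous_subtype_val
  have hKo : IsOpenMap K := by
    intro W hW
    obtain ⟨W', hW', rfl⟩ := isOpen_induced_iff.1 hW
    rw [isOpen_iff_mem_nhds]
    rintro _ ⟨z, hz, rfl⟩
    have hopen : IsOpen ((Subtype.val ⁻¹' (p '' (W' ∩ U (idx z))) : Set N) ×ˢ {idx z}) :=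
      ((ho _ (hW'.inter (hU _).2)).preimage continuous_subtype_val).prod (isOpen_discrete _)
    refine Filter.mem_of_superset (hopen.mem_nhds ⟨⟨z, ⟨hz, hidx z⟩, rfl⟩, rfl⟩) ?_
    rintro ⟨⟨c, hcN⟩, x⟩ ⟨⟨w, ⟨hwW, hwU⟩, rfl⟩, hx⟩
    obtain rfl : x = idx z := hx
    exact ⟨⟨w, hcN⟩, hwW, Prod.ext rfl (huniq ⟨w, hcN⟩ _ hwU)⟩
  have hKb : Function.Bijective K := by
    refine ⟨fun z z' h => hinj z z' (congrArg (fun q => q.1.1) h) (congrArg Prod.snd h), ?_⟩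
    rintro ⟨⟨c, hcN⟩, x⟩
    obtain ⟨w, hw, rfl⟩ := mem_iInter₂.1 hcN x.1 x.2
    exact ⟨⟨w, hcN⟩, Prod.ext rfl (huniq ⟨w, hcN⟩ x hw)⟩
  exact ⟨inferInstance, N, hbN, hN, hN.preimage hc,
    (Equiv.ofBijective K hKb).toHomeomorphOfContinuousOpen hKc hKo, fun _ => rfl⟩

/-- A continuous map defined on a convex set has limits at the points of the closure as soon as
its composition with a closed map with finite fibres does. -/
theorem IsClosedMap.exists_tendsto_of_convex {V X Y : Type*} [NormedAddCommGroup V]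
    [NormedSpace ℝ V] [TopologicalSpace X] [T2Space X] [TopologicalSpace Y] {p : X → Y}
    (hp : IsClosedMap p) {A : Set V} (hA : Convex ℝ A) {s : V → X} (hs : ContinuousOn s A)
    {v : V} (hv : v ∈ closure A) {y : Y} (hfin : (p ⁻¹' {y}).Finite)
    (hlim : Filter.Tendsto (p ∘ s) (𝓝[A] v) (𝓝 y)) :
    ∃ x, Filter.Tendsto s (𝓝[A] v) (𝓝 x) := by
  obtain ⟨U, hU, hdisj⟩ := hfin.t2_separation
  -- Closedness of `p`: a neighbourhood of the fibre contains the preimage of a neighbourhood of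
  -- `y`.
  have hev : ∀ W, IsOpen W → p ⁻¹' {y} ⊆ W → ∀ᶠ w in 𝓝[A] v, s w ∈ W := by
    intro W hW hFW
    have h1 : (p '' Wᶜ)ᶜ ∈ 𝓝 y := (hp _ hW.isClosed_compl).isOpen_compl.mem_nhds
      fun ⟨x, hx, hxy⟩ => hx (hFW hxy)
    filter_upwards [hlim h1] with w hw
    by_contra hwW
    exact hw ⟨s w, hwW, rfl⟩
  obtain ⟨r, hr, hrW⟩ := mem_nhdsWithin_iff.1 (hev (⋃ x ∈ p ⁻¹' {y}, U x)
    (isOpen_biUnion fun x _ => (hU x).2) fun x hx => mem_biUnion hx (hU x).1)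
  obtain ⟨v₀, hv₀A, hv₀⟩ := Metric.mem_closure_iff.1 hv r hr
  rw [dist_comm] at hv₀
  obtain ⟨x, hx, hxU⟩ := mem_iUnion₂.1 (hrW ⟨hv₀, hv₀A⟩)
  -- Convexity makes this image connected, so it cannot pass between the disjoint neighbourhoods of
  -- distinct fibre points; the one it stays in singles out the limit.
  have hconn : IsPreconnected (s '' (ball v r ∩ A)) :=
    ((convex_ball v r).inter hA).isPreconnected.image s (hs.mono inter_subset_right)
  have hother : IsOpen (⋃ x' ∈ p ⁻¹' {y} \ {x}, U x') := isOpen_biUnion fun x _ => (hU x).2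
  have hdisj' : Disjoint (U x) (⋃ x' ∈ p ⁻¹' {y} \ {x}, U x') :=
    disjoint_iUnion₂_right.2 fun x' hx' => hdisj hx hx'.1 (Ne.symm hx'.2)
  have hsub : s '' (ball v r ∩ A) ⊆ U x := by
    refine hconn.subset_left_of_subset_union (hU x).2 hother hdisj' ?_
      ⟨s v₀, ⟨v₀, ⟨hv₀, hv₀A⟩, rfl⟩, hxU⟩
    rintro _ ⟨w, hw, rfl⟩
    obtain ⟨x', hx', hwx'⟩ := mem_iUnion₂.1 (hrW hw)
    by_cases h : x' = x
    · exact Or.inl (h ▸ hwx')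
    · exact Or.inr (mem_iUnion₂.2 ⟨x', ⟨hx', h⟩, hwx'⟩)
  refine ⟨x, fun O hO => Filter.mem_map.2 ?_⟩
  obtain ⟨O', hO'O, hO', hxO'⟩ := mem_nhds_iff.1 hO
  filter_upwards [hev (O' ∪ ⋃ x' ∈ p ⁻¹' {y} \ {x}, U x') (hO'.union hother) (fun x' hx' => by
      by_cases h : x' = x
      · exact Or.inl (h ▸ hxO')
      · exact Or.inr (mem_iUnion₂.2 ⟨x', ⟨hx', h⟩, (hU x').1⟩)),
    inter_mem_nhdsWithin A (ball_mem_nhds v hr)] with w hw hw'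
  rcases hw with hw | hw
  · exact hO'O hw
  · exact (disjoint_left.1 hdisj' (hsub ⟨w, ⟨hw'.2, hw'.1⟩, rfl⟩) hw).elim

/-! ### Openness, closedness and lifting for branched coverings. -/

namespace BranchedCovering

variable {X Y : Type*} [TopologicalSpace X] [TopologicalSpace Y] {d : ℕ}

theorem mem_transfer_iff (h : BranchedCovering d X Y) {x : X} {y : Y} :
    x ∈ h.transfer y ↔ h.proj x = y := by
  refine ⟨fun hx => ?_, fun hx => hx ▸ h.mem_transfer x⟩
  exact Sym.eq_replicate_iff.1 (h.map_transfer y) _ (Sym.mem_map.2 ⟨x, hx, rfl⟩)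

theorem finite_fiber (h : BranchedCovering d X Y) (y : Y) : (h.proj ⁻¹' {y}).Finite := by
  refine (Multiset.finite_toSet (h.transfer y : Multiset X)).subset fun x hx => ?_
  exact h.mem_transfer_iff.2 hx

theorem isOpen_setOf_exists_mem {U : Set X} (hU : IsOpen U) :
    IsOpen {s : Sym X d | ∃ x ∈ s, x ∈ U} := by
  refine isOpen_coinduced.2 ?_
  have : (fun v : Fin d → X => (Sym.mk (Multiset.map v Finset.univ.val) (by simp) : Sym X d)) ⁻¹'
      {s : Sym X d | ∃ x ∈ s, x ∈ U} = ⋃ k, (fun v : Fin d → X => v k) ⁻¹' U := by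
    ext v
    simp [Sym.mem_mk]
  rw [this]
  exact isOpen_iUnion fun k => hU.preimage (continuous_apply k)

theorem isClosed_setOf_exists_mem {C : Set X} (hC : IsClosed C) :
    IsClosed {s : Sym X d | ∃ x ∈ s, x ∈ C} := by
  refine isClosed_coinduced.2 ?_
  have : (fun v : Fin d → X => (Sym.mk (Multiset.map v Finset.univ.val) (by simp) : Sym X d)) ⁻¹'
      {s : Sym X d | ∃ x ∈ s, x ∈ C} = ⋃ k, (fun v : Fin d → X => v k) ⁻¹' C := by
    ext v
    simp [Sym.mem_mk]
  rw [this]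
  exact isClosed_iUnion_of_finite fun k => hC.preimage (continuous_apply k)

/-- The support of the transfer is the whole fibre, so images under `proj` become preimages under
the continuous transfer; `proj` is thereby open and closed. -/
theorem image_proj_eq (h : BranchedCovering d X Y) (A : Set X) :
    h.proj '' A = h.transfer ⁻¹' {s | ∃ x ∈ s, x ∈ A} := by
  ext y
  constructor
  · rintro ⟨x, hx, rfl⟩
    exact ⟨x, h.mem_transfer x, hx⟩
  · rintro ⟨x, hx, hxA⟩
    exact ⟨x, hxA, h.mem_transfer_iff.1 hx⟩

theorem isOpenMap_proj (h : BranchedCovering d X Y) : IsOpenMap h.proj := fun U hU => by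
  rw [image_proj_eq]
  exact (isOpen_setOf_exists_mem hU).preimage h.transfer.continuous

theorem isClosedMap_proj (h : BranchedCovering d X Y) : IsClosedMap h.proj := fun C hC => by
  rw [image_proj_eq]
  exact (isClosed_setOf_exists_mem hC).preimage h.transfer.continuous

theorem compactSpace (h : BranchedCovering d X Y) [CompactSpace Y] : CompactSpace X := by
  have hp : IsProperMap h.proj := isProperMap_iff_isClosedMap_and_compact_fibers.2
    ⟨h.proj.continuous, h.isClosedMap_proj, fun y => (h.finite_fiber y).isCompact⟩
  exact ⟨by simpa using hp.isCompact_preimage isCompact_univ⟩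

variable [T2Space X]

theorem isCoveringMap_restrictPreimage (h : BranchedCovering d X Y) {s : Set Y}
    (hs : ∀ y ∈ s, ∀ y' ∈ s, (h.proj ⁻¹' {y}).encard = (h.proj ⁻¹' {y'}).encard) :
    IsCoveringMap (s.restrictPreimage h.proj) := by
  have himg : ∀ b : s, Subtype.val '' (s.restrictPreimage h.proj ⁻¹' {b}) = h.proj ⁻¹' {b.1} := by
    intro b
    ext x
    constructor
    · rintro ⟨z, hz, rfl⟩
      exact congrArg Subtype.val hz
    · intro hx
      have hx : h.proj x = b.1 := hx
      exact ⟨⟨x, by rw [mem_preimage, hx]; exact b.2⟩, Subtype.ext hx, rfl⟩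
  refine IsOpenMap.isCoveringMap_of_encard_eq h.proj.continuous.restrictPreimage
    (h.isOpenMap_proj.restrictPreimage s) (fun b => ?_) fun b b' => ?_
  · refine Finite.of_finite_image ?_ Subtype.val_injective.injOn
    rw [himg]
    exact h.finite_fiber _
  · rw [← Subtype.val_injective.encard_image, himg, ← Subtype.val_injective.encard_image, himg]
    exact hs _ b.2 _ b'.2

variable {n : ℕ} {ψ : (Fin n → ℝ) → Y}

theorem eqOn_ball_of_lifts (h : BranchedCovering d X Y)
    (hcard : ∀ y ∈ ψ '' ball 0 1, ∀ y' ∈ ψ '' ball 0 1,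
      (h.proj ⁻¹' {y}).encard = (h.proj ⁻¹' {y'}).encard) {s s' : (Fin n → ℝ) → X}
    (hs : ContinuousOn s (ball 0 1)) (hs' : ContinuousOn s' (ball 0 1))
    (hp : ∀ v ∈ ball 0 1, h.proj (s v) = ψ v) (hp' : ∀ v ∈ ball 0 1, h.proj (s' v) = ψ v)
    {u : Fin n → ℝ} (hu : u ∈ ball 0 1) (he : s u = s' u) : EqOn s s' (ball 0 1) := by
  have hcov := h.isCoveringMap_restrictPreimage hcard
  have : PreconnectedSpace (ball (0 : Fin n → ℝ) 1) :=
    Subtype.preconnectedSpace (convex_ball 0 1).isPreconnected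
  let g : ∀ s : (Fin n → ℝ) → X, (∀ v ∈ ball 0 1, h.proj (s v) = ψ v) → ball (0 : Fin n → ℝ) 1 →
      h.proj ⁻¹' (ψ '' ball 0 1) := fun s hp v =>
    ⟨s v, by rw [mem_preimage, hp v v.2]; exact mem_image_of_mem _ v.2⟩
  have heq := hcov.eq_of_comp_eq (g₁ := g s hp) (g₂ := g s' hp')
    (Continuous.subtype_mk hs.domRestrict _) (Continuous.subtype_mk hs'.domRestrict _)
    (funext fun v => Subtype.ext ((hp v v.2).trans (hp' v v.2).symm)) ⟨u, hu⟩ (Subtype.ext he)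
  exact fun v hv => congrArg Subtype.val (congrFun heq ⟨v, hv⟩)

/-- Over the open ball this is covering theory on a simply connected domain; boundary values are
limits, which exist because `proj` is closed with finite fibres. -/
theorem exists_lift_closedBall [T2Space Y] [CompactSpace Y] (h : BranchedCovering d X Y)
    (hψ : ContinuousOn ψ (closedBall 0 1))
    (hcard : ∀ y ∈ ψ '' ball 0 1, ∀ y' ∈ ψ '' ball 0 1,
      (h.proj ⁻¹' {y}).encard = (h.proj ⁻¹' {y'}).encard)
    {u : Fin n → ℝ} (hu : u ∈ ball 0 1) {x : X} (hx : h.proj x = ψ u) :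
    ∃ s : (Fin n → ℝ) → X, ContinuousOn s (closedBall 0 1) ∧
      (∀ v ∈ closedBall 0 1, h.proj (s v) = ψ v) ∧ s u = x := by
  classical
  -- Compact Hausdorff spaces are regular, as the continuity of an extension by limits requires.
  have := h.compactSpace
  have hcov := h.isCoveringMap_restrictPreimage hcard
  have : ContractibleSpace (ball (0 : Fin n → ℝ) 1) :=
    (convex_ball 0 1).contractibleSpace ⟨0, by simp⟩
  have : LocallyPathConnectedSpace (ball (0 : Fin n → ℝ) 1) :=
    isOpen_ball.locallyPathConnectedSpace
  let f : C(ball (0 : Fin n → ℝ) 1, ψ '' ball 0 1) :=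
    ⟨fun v => ⟨ψ v, mem_image_of_mem _ v.2⟩,
      Continuous.subtype_mk (hψ.mono ball_subset_closedBall).domRestrict _⟩
  obtain ⟨F, ⟨hF0, hF⟩, -⟩ := hcov.existsUnique_continuousMap_lifts f ⟨u, hu⟩
    ⟨x, by rw [mem_preimage, hx]; exact mem_image_of_mem _ hu⟩ (Subtype.ext hx)
  let s₀ : (Fin n → ℝ) → X := fun v => if hv : v ∈ ball 0 1 then (F ⟨v, hv⟩).1 else x
  have hs₀F : ∀ v (hv : v ∈ ball 0 1), s₀ v = (F ⟨v, hv⟩).1 := fun v hv => dif_pos hv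
  have hs₀ : ContinuousOn s₀ (ball 0 1) := by
    rw [continuousOn_iff_continuous_domRestrict]
    have : (ball 0 1).domRestrict s₀ = fun v => (F v).1 := funext fun v => hs₀F v v.2
    rw [this]
    exact continuous_subtype_val.comp F.continuous
  have hs₀p : ∀ v ∈ ball (0 : Fin n → ℝ) 1, h.proj (s₀ v) = ψ v := fun v hv => by
    rw [hs₀F v hv]
    exact congrArg Subtype.val (congrFun hF ⟨v, hv⟩)
  have hcl : closure (ball (0 : Fin n → ℝ) 1) = closedBall 0 1 := closure_ball _ one_ne_zero
  have hψlim : ∀ v ∈ closedBall (0 : Fin n → ℝ) 1,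
      Filter.Tendsto (h.proj ∘ s₀) (𝓝[ball 0 1] v) (𝓝 (ψ v)) := by
    intro v hv
    refine ((hψ v hv).mono ball_subset_closedBall).tendsto.congr' ?_
    filter_upwards [self_mem_nhdsWithin] with w hw
    exact (hs₀p w hw).symm
  have hlim : ∀ v ∈ closedBall (0 : Fin n → ℝ) 1, ∃ x, Filter.Tendsto s₀ (𝓝[ball 0 1] v) (𝓝 x) :=
    fun v hv => h.isClosedMap_proj.exists_tendsto_of_convex (convex_ball 0 1) hs₀ (hcl ▸ hv)
      (h.finite_fiber _) (hψlim v hv)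
  refine ⟨extendFrom (ball 0 1) s₀, continuousOn_extendFrom hcl.ge hlim, fun v hv => ?_, ?_⟩
  · obtain ⟨z, hz⟩ := hlim v hv
    rw [extendFrom_eq (hcl ▸ hv) hz]
    have : (𝓝[ball (0 : Fin n → ℝ) 1] v).NeBot := mem_closure_iff_nhdsWithin_neBot.1 (hcl ▸ hv)
    exact tendsto_nhds_unique ((h.proj.continuous.tendsto z).comp hz) (hψlim v hv)
  · rw [extendFrom_eq (subset_closure hu) (hs₀ u hu), hs₀F u hu, hF0]

end BranchedCovering

/-! ### The total space as a simple complex. -/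

open CWComplex in
/-- The total space of a finite branched covering over a compact space is a simple CW complex. -/
theorem BranchedCovering.IsFinite.exists_isSimpleCWComplex {X : Type u} {Y : Type}
    [TopologicalSpace X] [T2Space X] [TopologicalSpace Y] [T2Space Y] [CompactSpace Y] {d : ℕ}
    {h : BranchedCovering d X Y} (hf : h.IsFinite) :
    ∃ _ : CWComplex (univ : Set X), IsSimpleCWComplex X := by
  obtain ⟨S, hS, hcard⟩ := hf
  -- The cells above `e` are labelled by the fibre over its centre.
  let C : ℕ → Type u := fun n => Σ e : cell (univ : Set Y) n, {x : X // h.proj x = map n e 0}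
  choose φ hφc hφp hφ0 using fun n (i : C n) => h.exists_lift_closedBall (continuousOn n i.1)
    (hcard n i.1) (u := 0) (by simp) i.2.2
  have hcover : ∀ n (e : cell (univ : Set Y) n), ∀ y ∈ ball (0 : Fin n → ℝ) 1, ∀ z : X,
      h.proj z = map n e y → ∃ i : C n, φ n i y = z := by
    intro n e y hy z hz
    obtain ⟨s, hsc, hsp, rfl⟩ := h.exists_lift_closedBall (continuousOn n e) (hcard n e) hy hz
    let i : C n := ⟨e, s 0, hsp 0 (by simp)⟩
    exact ⟨i, h.eqOn_ball_of_lifts (hcard n e) ((hφc n i).mono ball_subset_closedBall)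
      (hsc.mono ball_subset_closedBall) (fun v hv => hφp n i v (ball_subset_closedBall hv))
      (fun v hv => hsp v (ball_subset_closedBall hv)) (u := 0) (by simp) (hφ0 n i) hy⟩
  have hfin : ∀ n, Finite (C n) := fun n => by
    have := hS.finite_cell n
    have : ∀ e : cell (univ : Set Y) n, Finite {x : X // h.proj x = map n e 0} :=
      fun e => h.finite_fiber (map n e 0)
    infer_instance
  obtain ⟨S', hS', -⟩ := _root_.exists_isSimpleCWComplex C hfin φ hφc
    (by
      intro n i x hx y hy hxy
      refine hS.injOn_map n i.1 hx hy ?_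
      rw [← hφp n i x hx, ← hφp n i y hy, hxy])
    (by
      intro n i m j x hx y hy hxy
      have hmap : map n i.1 x = map m j.1 y := by
        rw [← hφp n i x (ball_subset_closedBall hx), ← hφp m j y (ball_subset_closedBall hy), hxy]
      have hcell : (⟨n, i.1⟩ : Σ n, cell (univ : Set Y) n) = ⟨m, j.1⟩ := by
        by_contra hne
        exact disjoint_left.1 (disjoint_openCell_of_ne hne) (mem_image_of_mem _ hx)
          (hmap ▸ mem_image_of_mem _ hy)
      obtain ⟨e, z⟩ := i
      obtain ⟨e', z'⟩ := j
      obtain ⟨rfl, he⟩ := Sigma.mk.inj_iff.1 hcell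
      obtain rfl := eq_of_heq he
      obtain rfl := hS.injOn_map n e (ball_subset_closedBall hx) (ball_subset_closedBall hy) hmap
      -- Two lifts of the same cell that meet agree on the ball, so their labels at the centre
      -- coincide.
      have heq := h.eqOn_ball_of_lifts (hcard n e)
        ((hφc n ⟨e, z⟩).mono ball_subset_closedBall) ((hφc n ⟨e, z'⟩).mono ball_subset_closedBall)
        (fun v hv => hφp n _ v (ball_subset_closedBall hv))
        (fun v hv => hφp n _ v (ball_subset_closedBall hv)) hx hxy (x := 0) (by simp)
      rw [hφ0, hφ0] at heq
      obtain rfl : z = z' := Subtype.ext heq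
      rfl)
    (by
      intro n i x hx
      have h1 := cellFrontier_subset_skeletonLT n i.1 (mem_image_of_mem _ hx)
      obtain ⟨m, hm, e, y, hy, hyx⟩ := mem_skeletonLT_iff.1 h1
      obtain ⟨j, hj⟩ := hcover m e y hy (φ n i x) (by
        rw [hφp n i x (sphere_subset_closedBall hx), hyx])
      exact ⟨m, by exact_mod_cast hm, j, y, ball_subset_closedBall hy, hj⟩)
    (by
      intro z
      have h1 : h.proj z ∈ (univ : Set Y) := mem_univ _
      rw [← iUnion_openCell_eq_complex (C := (univ : Set Y))] at h1
      obtain ⟨n, e, y, hy, hyz⟩ := mem_iUnion₂.1 h1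
      obtain ⟨j, hj⟩ := hcover n e y hy z hyz.symm
      exact ⟨n, j, y, ball_subset_closedBall hy, hj⟩)
    (by
      obtain ⟨n, hempty, hdense⟩ := hS.pure
      refine ⟨n, fun m hm => ⟨fun i => (hempty m hm).false i.1⟩, ?_⟩
      -- Purity passes upwards because preimages of dense sets under open maps are dense.
      have hd := (dense_iff_closure_eq.2 hdense).preimage h.isOpenMap_proj
      refine dense_iff_closure_eq.1 (hd.mono fun z hz => ?_)
      obtain ⟨e, y, hy, hyz⟩ := mem_iUnion.1 hz
      obtain ⟨i, hi⟩ := hcover n e y hy z hyz.symm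
      exact mem_iUnion.2 ⟨i, y, hy, hi⟩)
  exact ⟨S', hS'⟩

theorem theorem2p1 {Ω : Type*} [TopologicalSpace Ω] [T2Space Ω] :
    (∃ _ : CWComplex (univ : Set Ω), IsSimpleCWComplex Ω) ↔
      ∃ (n d : ℕ) (h : BranchedCovering d Ω (closedBall (0 : EuclideanSpace ℝ (Fin n)) 1)),
        h.IsFinite := by
  constructor
  · rintro ⟨_, hΩ⟩
    exact hΩ.exists_branchedCovering_isFinite
  · rintro ⟨n, d, h, hf⟩
    exact hf.exists_isSimpleCWComplex
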